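/- For an $n\times n$ complex matrix $A$ and $k\ge 1$, let $\Lambda_k(A)=\{c\in\mathbb{C} : X^*AX=cI_k \text{ for some } n\times k \text{ complex matrix } X \text{ with } X^*X=I_k\}$ be its rank-$k$ numerical range. Write $\operatorname{Re}A=(A+A^*)/2$ and $\operatorname{Im}A=(A-A^*)/(2i)$, and let $p_A(x,y,z)=\det(x\operatorname{Re}A+y\operatorname{Im}A+zI_n)$ be the Kippenhahn polynomial of $A$, a homogeneous polynomial with real coefficients. For an $n\times n$ Hermitian matrix $Y$, let $\lambda_1(Y)\ge\cdots\ge\lambda_n(Y)$ be its eigenvalues, counted with multiplicity. For $1\le\ell\le\lfloor n/2\rfloor$, let $V_\ell(A)$ be the set of all $a+bi$ ($a,b\in\mathbb{R}$) for which there is an integer $m$ with $1\le m\le\lfloor n/2\rfloor-\ell+1$ such that $ax+by+z$ is a factor of $p_A(x,y,z)$ of multiplicity exactly $m$ and $a+bi\in\Lambda_{\ell+m-1}(A)\setminus\Lambda_{\ell+m}(A)$. Lemma 11. Let $A$ and $B$ be $n\times n$ complex matrices with $\Lambda_k(A)=\Lambda_k(B)$ for all $1\le k\le\lfloor n/2\rfloor+1$.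 Then, for all $1\le\ell\le\lfloor n/2\rfloor$, $V_\ell(A)=V_\ell(B)$ and $\lambda_\ell(\operatorname{Re}(e^{-i\theta}A))=\lambda_\ell(\operatorname{Re}(e^{-i\theta}B))$ for every $\theta\in\mathbb{R}$. -/

import Mathlib

open scoped Matrix ComplexStarModule

/-- The rank-`k` numerical range `Λ_k(A)` of an `n × n` complex matrix `A`: all `c ∈ ℂ` such that
`X* A X = c I_k` for some `n × k` complex matrix `X` with `X* X = I_k`. -/
def rankNumericalRange {n : ℕ} (k : ℕ) (A : Matrix (Fin n) (Fin n) ℂ) : Set ℂ :=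
  {c | ∃ X : Matrix (Fin n) (Fin k) ℂ, Xᴴ * X = 1 ∧ Xᴴ * A * X = c • (1 : Matrix (Fin k) (Fin k) ℂ)}

/-- The Kippenhahn polynomial `p_A(x, y, z) = det (x Re A + y Im A + z I_n)`, where
`Re A = (A + A*) / 2`, `Im A = (A - A*) / (2i)`, and `x, y, z` are the variables `X 0, X 1, X 2`.
Its coefficients are real numbers; it is written here in `ℂ[x, y, z]`. -/
noncomputable def kippenhahnPoly {n : ℕ} (A : Matrix (Fin n) (Fin n) ℂ) :
    MvPolynomial (Fin 3) ℂ :=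
  ((MvPolynomial.X 0 : MvPolynomial (Fin 3) ℂ) •
      ((ℜ A : selfAdjoint (Matrix (Fin n) (Fin n) ℂ)) : Matrix (Fin n) (Fin n) ℂ).map
        MvPolynomial.C
    + (MvPolynomial.X 1 : MvPolynomial (Fin 3) ℂ) •
      ((ℑ A : selfAdjoint (Matrix (Fin n) (Fin n) ℂ)) : Matrix (Fin n) (Fin n) ℂ).map
        MvPolynomial.C
    + (MvPolynomial.X 2 : MvPolynomial (Fin 3) ℂ) •
      (1 : Matrix (Fin n) (Fin n) (MvPolynomial (Fin 3) ℂ))).det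

/-- The real linear form `a x + b y + z` attached to the point `w = a + b i`. Its multiplicity as a
factor of a polynomial with real coefficients is the same over `ℝ` and over `ℂ`. -/
noncomputable def linearForm (w : ℂ) : MvPolynomial (Fin 3) ℂ :=
  MvPolynomial.C (w.re : ℂ) * MvPolynomial.X 0 + MvPolynomial.C (w.im : ℂ) * MvPolynomial.X 1
    + MvPolynomial.X 2

/-- The set `V_ℓ(A)`, `1 ≤ ℓ ≤ ⌊n/2⌋`: all `w = a + b i` such that `a x + b y + z` is a factor of
`p_A` of multiplicity exactly `m`, where `1 ≤ m ≤ ⌊n/2⌋ - ℓ + 1`, and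
`w ∈ Λ_{ℓ+m-1}(A) \ Λ_{ℓ+m}(A)`. -/
def linearFactorSet {n : ℕ} (ℓ : ℕ) (A : Matrix (Fin n) (Fin n) ℂ) : Set ℂ :=
  {w | ∃ m : ℕ, 1 ≤ m ∧ ℓ + m ≤ n / 2 + 1 ∧
    emultiplicity (linearForm w) (kippenhahnPoly A) = m ∧
    w ∈ rankNumericalRange (ℓ + m - 1) A \ rankNumericalRange (ℓ + m) A}

/-- The `ℓ`-th largest eigenvalue `λ_ℓ(Re X)`, `1 ≤ ℓ ≤ n`, of the Hermitian matrix
`Re X = (X + X*) / 2`, counted with multiplicity: `λ_1(Re X) ≥ ⋯ ≥ λ_n(Re X)`. -/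
noncomputable def eigenvalueRe {n : ℕ} (X : Matrix (Fin n) (Fin n) ℂ) (ℓ : ℕ)
    (h₁ : 1 ≤ ℓ) (h₂ : ℓ ≤ n) : ℝ :=
  Matrix.IsHermitian.eigenvalues₀
    (A := ((ℜ X : selfAdjoint (Matrix (Fin n) (Fin n) ℂ)) : Matrix (Fin n) (Fin n) ℂ))
    (ℜ X).2 ⟨ℓ - 1, by rw [Fintype.card_fin]; omega⟩

/-! The hypothesis forces more than the conclusion: all eigenvalue functions `λ_i(x Re A + y Im A)`
agree for `A` and `B`, hence so do the Kippenhahn polynomials, and the sets `V_ℓ` then involve only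
data shared by the two matrices.

The first ingredient is the Li–Sze theorem (`HasNonnegIndex.exists_isotropic`,
`mem_rankNumericalRange_iff_le_pencilEig`): `Λ_k` consists of the points `a + bi` with `xa + yb ≤
λ_k(x Re A + y Im A)` for all real `(x, y)`. Since `λ_k` need not be convex, `Λ_k` sees only its
linear minorants and does not determine `λ_k` directly.

The second is hyperbolicity. A monic factor `q` of the characteristic polynomial of the generic
pencil has only real roots at real points. Its largest root is positively homogeneous and
subadditive (`IsRootFamily.top_add_le`), so it has a supporting linear functional in every direction
(`IsRootFamily.exists_support`).

They meet in `pencilEig_le_of_rankNumericalRange_subset`, by induction on the index. Suppose the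
earlier eigenvalues agree but `λ_i(A) > λ_i(B)` at some point, which may be taken generic. Let `q`
be a prime factor having `λ_i(A)` as a root there. Comparing the generic multiplicities of the roots
of `q` as eigenvalues of the two pencils shows that the largest root of `q` never exceeds `λ_i(A)`
and equals it at the chosen point. A supporting functional there is a point of the numerical range
of `A`, hence of `B`, which contradicts the strict inequality. The remaining lower eigenvalues
follow from `(x, y) ↦ (-x, -y)`. -/

/-! ### Real quadratic forms of an operator: inertia, compactness bounds and perturbation. -/

section QuadraticForms

set_option linter.unusedSectionVars false

open scoped ComplexConjugate InnerProductSpace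
open Module

variable {E : Type*} [NormedAddCommGroup E] [InnerProductSpace ℂ E] [FiniteDimensional ℂ E]

/-- The real quadratic form `x ↦ Re (ζ ⟪x, A x⟫)`. -/
noncomputable def numForm (A : E →ₗ[ℂ] E) (ζ : ℂ) (x : E) : ℝ := (ζ * inner ℂ x (A x)).re

/-- The symmetric operator `ζ A + (ζ A)*`, which represents twice the form `numForm A ζ`. -/
noncomputable def hermPart (A : E →ₗ[ℂ] E) (ζ : ℂ) : E →ₗ[ℂ] E :=
  ζ • A + conj ζ • LinearMap.adjoint A

theorem hermPart_isSymmetric (A : E →ₗ[ℂ] E) (ζ : ℂ) : (hermPart A ζ).IsSymmetric := by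
  intro x y
  simp only [hermPart, LinearMap.add_apply, LinearMap.smul_apply, inner_add_left, inner_add_right,
    inner_smul_left, inner_smul_right, LinearMap.adjoint_inner_left, LinearMap.adjoint_inner_right,
    Complex.conj_conj]
  ring

theorem inner_hermPart_re (A : E →ₗ[ℂ] E) (ζ : ℂ) (x : E) :
    (inner ℂ x (hermPart A ζ x)).re = 2 * numForm A ζ x := by
  have h : inner ℂ (A x) x = conj (inner ℂ x (A x)) := (inner_conj_symm _ _).symm
  simp only [hermPart, numForm, LinearMap.add_apply, LinearMap.smul_apply, inner_add_right,
    inner_smul_right, LinearMap.adjoint_inner_right, h, ← map_mul, Complex.add_re, Complex.conj_re]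
  ring

theorem inner_hermPart_self (A : E →ₗ[ℂ] E) (ζ : ℂ) (x : E) :
    inner ℂ x (hermPart A ζ x) = ((2 * numForm A ζ x : ℝ) : ℂ) := by
  rw [← inner_hermPart_re]
  exact ((hermPart_isSymmetric A ζ).coe_re_inner_self_apply x).symm

theorem numForm_add_left (A : E →ₗ[ℂ] E) (ζ η : ℂ) (x : E) :
    numForm A (ζ + η) x = numForm A ζ x + numForm A η x := by
  simp [numForm, add_mul]

theorem numForm_real_mul (A : E →ₗ[ℂ] E) (r : ℝ) (ζ : ℂ) (x : E) :
    numForm A (r * ζ) x = r * numForm A ζ x := by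
  simp [numForm, mul_assoc]

theorem numForm_smul (A : E →ₗ[ℂ] E) (ζ c : ℂ) (x : E) :
    numForm A ζ (c • x) = ‖c‖ ^ 2 * numForm A ζ x := by
  have : ζ * inner ℂ (c • x) (A (c • x)) = ((‖c‖ ^ 2 : ℝ) : ℂ) * (ζ * inner ℂ x (A x)) := by
    simp only [map_smul, inner_smul_left, inner_smul_right]
    have := Complex.conj_mul' c
    push_cast
    rw [← this]; ring
  rw [numForm, this, Complex.re_ofReal_mul, numForm]

theorem continuous_numForm (A : E →ₗ[ℂ] E) (ζ : ℂ) : Continuous (numForm A ζ) := by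
  have : Continuous A := A.continuous_of_finiteDimensional
  unfold numForm
  fun_prop

theorem exists_numForm_bound (A : E →ₗ[ℂ] E) :
    ∃ C : ℝ, 0 < C ∧ ∀ ζ x, |numForm A ζ x| ≤ ‖ζ‖ * C * ‖x‖ ^ 2 := by
  refine ⟨‖LinearMap.toContinuousLinearMap A‖ + 1, by positivity, fun ζ x => ?_⟩
  have h1 : ‖A x‖ ≤ ‖LinearMap.toContinuousLinearMap A‖ * ‖x‖ :=
    (LinearMap.toContinuousLinearMap A).le_opNorm x
  calc |numForm A ζ x| ≤ ‖ζ * inner ℂ x (A x)‖ := Complex.abs_re_le_norm _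
    _ = ‖ζ‖ * ‖inner ℂ x (A x)‖ := norm_mul _ _
    _ ≤ ‖ζ‖ * (‖x‖ * ‖A x‖) := by gcongr; exact norm_inner_le_norm _ _
    _ ≤ ‖ζ‖ * (‖x‖ * ((‖LinearMap.toContinuousLinearMap A‖ + 1) * ‖x‖)) := by
        gcongr; nlinarith [norm_nonneg x]
    _ = _ := by ring

theorem numForm_add_of_hermPart_orthogonal (A : E →ₗ[ℂ] E) (ζ : ℂ) (x u : E)
    (h : inner ℂ x (hermPart A ζ u) = 0) :
    numForm A ζ (x + u) = numForm A ζ x + numForm A ζ u := by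
  have h' : inner ℂ u (hermPart A ζ x) = 0 := by
    rw [← hermPart_isSymmetric A ζ u x, ← inner_conj_symm, h, map_zero]
  have e := inner_hermPart_re A ζ (x + u)
  rw [map_add, inner_add_left, inner_add_right, inner_add_right, h, h'] at e
  simp only [Complex.add_re, Complex.zero_re, inner_hermPart_re] at e
  linarith

/-- The subspace of vectors supported on the eigenvectors with index in `s`. -/
theorem LinearMap.IsSymmetric.exists_spectral_submodule {T : E →ₗ[ℂ] E} (hT : T.IsSymmetric)
    {n : ℕ} (hn : finrank ℂ E = n) (s : Finset (Fin n)) :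
    ∃ P : Submodule ℂ E, finrank ℂ P = s.card ∧ ∀ x ∈ P,
      (∀ i ∉ s, (hT.eigenvectorBasis hn).repr x i = 0) ∧
      (inner ℂ x (T x)).re =
        ∑ i ∈ s, hT.eigenvalues hn i * ‖(hT.eigenvectorBasis hn).repr x i‖ ^ 2 ∧
      ‖x‖ ^ 2 = ∑ i ∈ s, ‖(hT.eigenvectorBasis hn).repr x i‖ ^ 2 := by
  set b := hT.eigenvectorBasis hn with hb
  refine ⟨Submodule.span ℂ (Set.range fun i : s => b i), ?_, fun x hx => ?_⟩
  · have hli : LinearIndependent ℂ fun i : s => b i :=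
      b.orthonormal.linearIndependent.comp _ Subtype.val_injective
    rw [finrank_span_eq_card hli, Fintype.card_coe]
  · have h0 : ∀ i ∉ s, b.repr x i = 0 := by
      intro i hi
      induction hx using Submodule.span_induction with
      | mem y hy =>
        obtain ⟨j, rfl⟩ := hy
        have : i ≠ j := fun h => hi (h ▸ j.2)
        simp [b.repr_self, this]
      | zero => simp
      | add y z _ _ hy hz => simp [hy, hz]
      | smul c y _ hy => simp [hy]
    refine ⟨h0, ?_, ?_⟩
    · have h1 : (inner ℂ x (T x)) = ∑ i, ((hT.eigenvalues hn i * ‖b.repr x i‖ ^ 2 : ℝ) : ℂ) := by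
        rw [← b.repr.inner_map_map x (T x), PiLp.inner_apply]
        refine Finset.sum_congr rfl fun i _ => ?_
        rw [hb, hT.eigenvectorBasis_apply_self_apply hn x i]
        simp only [RCLike.inner_apply]
        have := Complex.mul_conj' (b.repr x i)
        push_cast
        rw [← this]
        simp; ring
      rw [h1, ← Complex.ofReal_sum, Complex.ofReal_re]
      exact (Finset.sum_subset (Finset.subset_univ s) fun i _ hi => by simp [h0 i hi]).symm
    · rw [← b.repr.norm_map x, EuclideanSpace.norm_sq_eq]
      exact (Finset.sum_subset (Finset.subset_univ s) fun i _ hi => by simp [h0 i hi]).symm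

/-- Split an eigenbasis by the sign of the eigenvalue: if fewer than `k` are nonnegative, the others
span `V`. The second alternative is what dimension counts refute, since `V` meets every
`k`-dimensional subspace. -/
theorem LinearMap.IsSymmetric.exists_nonneg_or_neg {T : E →ₗ[ℂ] E} (hT : T.IsSymmetric) (k : ℕ) :
    (∃ P : Submodule ℂ E, k ≤ finrank ℂ P ∧ ∀ x ∈ P, 0 ≤ (inner ℂ x (T x)).re) ∨
    ∃ V : Submodule ℂ E, finrank ℂ E < finrank ℂ V + k ∧
      ∀ x ∈ V, x ≠ 0 → (inner ℂ x (T x)).re < 0 := by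
  classical
  set s : Finset (Fin (finrank ℂ E)) := {i | 0 ≤ hT.eigenvalues rfl i} with hs
  obtain ⟨P, hP, hP'⟩ := hT.exists_spectral_submodule rfl s
  obtain ⟨V, hV, hV'⟩ := hT.exists_spectral_submodule rfl sᶜ
  by_cases hk : k ≤ s.card
  · refine Or.inl ⟨P, hP ▸ hk, fun x hx => ?_⟩
    rw [(hP' x hx).2.1]
    refine Finset.sum_nonneg fun i hi => ?_
    have : 0 ≤ hT.eigenvalues rfl i := by simpa [hs] using hi
    positivity
  · refine Or.inr ⟨V, ?_, fun x hx hx0 => ?_⟩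
    · have := s.card_add_card_compl
      rw [Fintype.card_fin] at this
      omega
    · rw [(hV' x hx).2.1]
      have hpos : 0 < ‖x‖ ^ 2 := by positivity
      rw [(hV' x hx).2.2] at hpos
      obtain ⟨i, hi, hi'⟩ := Finset.exists_lt_of_sum_lt (s := sᶜ) (f := fun _ => (0 : ℝ))
        (by simpa using hpos)
      have hneg : ∀ i ∈ sᶜ, hT.eigenvalues rfl i < 0 := by
        intro i hi
        simpa [hs] using hi
      refine Finset.sum_neg' (fun j hj => ?_) ⟨i, hi, ?_⟩
      · exact mul_nonpos_of_nonpos_of_nonneg (hneg j hj).le (by positivity)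
      · exact mul_neg_of_neg_of_pos (hneg i hi) hi'

/-- Here zero eigenvalues go to `V`. A vanishing sum of nonpositive terms has only zero terms, so
null vectors of the form in `V` lie in the kernel of `T`. -/
theorem LinearMap.IsSymmetric.exists_pos_or_nonpos {T : E →ₗ[ℂ] E} (hT : T.IsSymmetric) (k : ℕ) :
    (∃ P : Submodule ℂ E, k ≤ finrank ℂ P ∧ ∀ x ∈ P, x ≠ 0 → 0 < (inner ℂ x (T x)).re) ∨
    ∃ V : Submodule ℂ E, finrank ℂ E < finrank ℂ V + k ∧
      ∀ x ∈ V, (inner ℂ x (T x)).re ≤ 0 ∧ ((inner ℂ x (T x)).re = 0 → T x = 0) := by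
  classical
  set s : Finset (Fin (finrank ℂ E)) := {i | 0 < hT.eigenvalues rfl i} with hs
  obtain ⟨P, hP, hP'⟩ := hT.exists_spectral_submodule rfl s
  obtain ⟨V, hV, hV'⟩ := hT.exists_spectral_submodule rfl sᶜ
  by_cases hk : k ≤ s.card
  · refine Or.inl ⟨P, hP ▸ hk, fun x hx hx0 => ?_⟩
    rw [(hP' x hx).2.1]
    have hpos : 0 < ‖x‖ ^ 2 := by positivity
    rw [(hP' x hx).2.2] at hpos
    obtain ⟨i, hi, hi'⟩ := Finset.exists_lt_of_sum_lt (s := s) (f := fun _ => (0 : ℝ))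
      (by simpa using hpos)
    have hpos' : ∀ i ∈ s, 0 < hT.eigenvalues rfl i := by
      intro i hi
      simpa [hs] using hi
    refine Finset.sum_pos' (fun j hj => ?_) ⟨i, hi, ?_⟩
    · exact mul_nonneg (hpos' j hj).le (by positivity)
    · exact mul_pos (hpos' i hi) hi'
  · have hneg : ∀ i ∈ sᶜ, hT.eigenvalues rfl i ≤ 0 := by
      intro i hi
      simpa [hs] using hi
    refine Or.inr ⟨V, ?_, fun x hx => ⟨?_, fun h0 => ?_⟩⟩
    · have := s.card_add_card_compl
      rw [Fintype.card_fin] at this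
      omega
    · rw [(hV' x hx).2.1]
      exact Finset.sum_nonpos fun j hj =>
        mul_nonpos_of_nonpos_of_nonneg (hneg j hj) (by positivity)
    · rw [(hV' x hx).2.1, Finset.sum_eq_zero_iff_of_nonpos fun j hj =>
        mul_nonpos_of_nonpos_of_nonneg (hneg j hj) (by positivity)] at h0
      apply (hT.eigenvectorBasis rfl).repr.injective
      ext i
      rw [hT.eigenvectorBasis_apply_self_apply rfl x i, map_zero, PiLp.zero_apply]
      by_cases hi : i ∈ sᶜ
      · rcases mul_eq_zero.mp (h0 i hi) with h | h
        · simp [h]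
        · have : (hT.eigenvectorBasis rfl).repr x i = 0 := by simpa using h
          simp [this]
      · simp [(hV' x hx).1 i hi]

theorem Submodule.exists_ne_zero_mem_inf {P V : Submodule ℂ E}
    (h : finrank ℂ E < finrank ℂ P + finrank ℂ V) : ∃ x, x ∈ P ∧ x ∈ V ∧ x ≠ 0 := by
  have h1 := Submodule.finrank_sup_add_finrank_inf_eq P V
  have h2 := Submodule.finrank_le (P ⊔ V)
  have h3 : P ⊓ V ≠ ⊥ := by
    intro h0
    rw [h0, finrank_bot] at h1
    omega
  obtain ⟨x, hx, hx0⟩ := Submodule.exists_mem_ne_zero_of_ne_bot h3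
  exact ⟨x, hx.1, hx.2, hx0⟩

theorem exists_nonneg_or_neg_numForm (A : E →ₗ[ℂ] E) (ζ : ℂ) (k : ℕ) :
    (∃ P : Submodule ℂ E, k ≤ finrank ℂ P ∧ ∀ x ∈ P, 0 ≤ numForm A ζ x) ∨
    ∃ V : Submodule ℂ E, finrank ℂ E < finrank ℂ V + k ∧
      ∀ x ∈ V, x ≠ 0 → numForm A ζ x < 0 := by
  rcases (hermPart_isSymmetric A ζ).exists_nonneg_or_neg k with ⟨P, h, h'⟩ | ⟨V, h, h'⟩
  · refine Or.inl ⟨P, h, fun x hx => ?_⟩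
    have := h' x hx
    rw [inner_hermPart_re] at this
    linarith
  · refine Or.inr ⟨V, h, fun x hx hx0 => ?_⟩
    have := h' x hx hx0
    rw [inner_hermPart_re] at this
    linarith

theorem exists_pos_or_nonpos_numForm (A : E →ₗ[ℂ] E) (ζ : ℂ) (k : ℕ) :
    (∃ P : Submodule ℂ E, k ≤ finrank ℂ P ∧ ∀ x ∈ P, x ≠ 0 → 0 < numForm A ζ x) ∨
    ∃ V : Submodule ℂ E, finrank ℂ E < finrank ℂ V + k ∧
      ∀ x ∈ V, numForm A ζ x ≤ 0 ∧ (numForm A ζ x = 0 → hermPart A ζ x = 0) := by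
  rcases (hermPart_isSymmetric A ζ).exists_pos_or_nonpos k with ⟨P, h, h'⟩ | ⟨V, h, h'⟩
  · refine Or.inl ⟨P, h, fun x hx hx0 => ?_⟩
    have := h' x hx hx0
    rw [inner_hermPart_re] at this
    linarith
  · refine Or.inr ⟨V, h, fun x hx => ?_⟩
    have := h' x hx
    rw [inner_hermPart_re] at this
    exact ⟨by linarith [this.1], fun h0 => this.2 (by rw [h0, mul_zero])⟩

/-- A form positive definite on a subspace is bounded below there. -/
theorem exists_pos_bound_numForm (A : E →ₗ[ℂ] E) (ζ : ℂ) (P : Submodule ℂ E)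
    (h : ∀ x ∈ P, x ≠ 0 → 0 < numForm A ζ x) :
    ∃ ε : ℝ, 0 < ε ∧ ∀ x ∈ P, ε * ‖x‖ ^ 2 ≤ numForm A ζ x := by
  have hc : IsCompact (Metric.sphere (0 : E) 1 ∩ P) := by
    have := FiniteDimensional.proper ℂ E
    exact (isCompact_sphere 0 1).inter_right P.closed_of_finiteDimensional
  rcases (Metric.sphere (0 : E) 1 ∩ P).eq_empty_or_nonempty with he | hne
  · refine ⟨1, one_pos, fun x hx => ?_⟩
    rcases eq_or_ne x 0 with rfl | hx0
    · simp [numForm]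
    · exfalso
      have : ((‖x‖⁻¹ : ℝ) : ℂ) • x ∈ Metric.sphere (0 : E) 1 ∩ P :=
        ⟨by simp [norm_smul, hx0], P.smul_mem _ hx⟩
      rw [he] at this
      exact this
  · obtain ⟨y, hy, hmin⟩ := hc.exists_isMinOn hne (continuous_numForm A ζ).continuousOn
    have hy0 : y ≠ 0 := by
      rintro rfl
      simpa using hy.1
    refine ⟨numForm A ζ y, h y hy.2 hy0, fun x hx => ?_⟩
    rcases eq_or_ne x 0 with rfl | hx0
    · simp [numForm]
    · have hmem : ((‖x‖⁻¹ : ℝ) : ℂ) • x ∈ Metric.sphere (0 : E) 1 ∩ P :=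
        ⟨by simp [norm_smul, hx0], P.smul_mem _ hx⟩
      have h1 := hmin hmem
      rw [Set.mem_ofPred_eq, numForm_smul] at h1
      have hpos : 0 < ‖x‖ := norm_pos_iff.mpr hx0
      simp only [Complex.norm_real, norm_inv, norm_norm] at h1
      calc numForm A ζ y * ‖x‖ ^ 2 ≤ (‖x‖⁻¹ ^ 2 * numForm A ζ x) * ‖x‖ ^ 2 := by gcongr
        _ = numForm A ζ x := by field_simp

theorem numForm_neg_left (A : E →ₗ[ℂ] E) (ζ : ℂ) (x : E) : numForm A (-ζ) x = -numForm A ζ x := by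
  simp [numForm]

theorem exists_neg_bound_numForm (A : E →ₗ[ℂ] E) (ζ : ℂ) (P : Submodule ℂ E)
    (h : ∀ x ∈ P, x ≠ 0 → numForm A ζ x < 0) :
    ∃ ε : ℝ, 0 < ε ∧ ∀ x ∈ P, numForm A ζ x ≤ -ε * ‖x‖ ^ 2 := by
  obtain ⟨ε, hε, h'⟩ := exists_pos_bound_numForm A (-ζ) P fun x hx hx0 => by
    rw [numForm_neg_left]; linarith [h x hx hx0]
  refine ⟨ε, hε, fun x hx => ?_⟩
  have := h' x hx
  rw [numForm_neg_left] at this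
  linarith

/-- If `ζ`-form is `≤ 0` on `V` and the `η`-form is positive where it vanishes, then a small
perturbation of the first by the second is negative definite on `V`. -/
theorem exists_perturbation_neg (A : E →ₗ[ℂ] E) (ζ η : ℂ) (V : Submodule ℂ E)
    (h : ∀ x ∈ V, numForm A ζ x ≤ 0)
    (h' : ∀ x ∈ V, x ≠ 0 → numForm A ζ x = 0 → 0 < numForm A η x) :
    ∃ δ : ℝ, 0 < δ ∧ ∀ x ∈ V, x ≠ 0 → numForm A (ζ - δ * η) x < 0 := by
  obtain ⟨C, hC, hC'⟩ := exists_numForm_bound A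
  have key : ∃ δ : ℝ, 0 < δ ∧ ∀ x ∈ Metric.sphere (0 : E) 1 ∩ V,
      numForm A ζ x - δ * numForm A η x < 0 := by
    -- Subtracting `δ η` can only hurt where the `η`-form is nonpositive. On this compact set the
    -- `ζ`-form never vanishes, so its maximum is negative.
    have hc : IsCompact ((Metric.sphere (0 : E) 1 ∩ V) ∩ {x | numForm A η x ≤ 0}) := by
      have := FiniteDimensional.proper ℂ E
      exact ((isCompact_sphere 0 1).inter_right V.closed_of_finiteDimensional).inter_right
        (isClosed_le (continuous_numForm A η) continuous_const)
    rcases Set.eq_empty_or_nonempty ((Metric.sphere (0 : E) 1 ∩ V) ∩ {x | numForm A η x ≤ 0})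
      with he | hne
    · refine ⟨1, one_pos, fun x hx => ?_⟩
      have : 0 < numForm A η x := by
        by_contra hcon
        have : x ∈ ((Metric.sphere (0 : E) 1 ∩ V) ∩ {x | numForm A η x ≤ 0}) :=
          ⟨hx, not_lt.mp hcon⟩
        rw [he] at this
        exact this
      linarith [h x hx.2]
    · obtain ⟨y, hy, hmax⟩ := hc.exists_isMaxOn hne (continuous_numForm A ζ).continuousOn
      have hy0 : y ≠ 0 := by
        rintro rfl
        simpa using hy.1.1
      have hyneg : numForm A ζ y < 0 := by
        refine lt_of_le_of_ne (h y hy.1.2) fun h0 => ?_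
        exact absurd (h' y hy.1.2 hy0 h0) (not_lt.mpr hy.2)
      -- `D` bounds the `η`-form on the unit sphere; the `δ` below uses up half of the negative
      -- margin.
      set D := ‖η‖ * C + 1 with hD
      have hDpos : 0 < D := by positivity
      refine ⟨-numForm A ζ y / (2 * D), div_pos (by linarith) (by positivity), fun x hx => ?_⟩
      have hδ : 0 < -numForm A ζ y / (2 * D) := div_pos (by linarith) (by positivity)
      by_cases hg : numForm A η x ≤ 0
      · have h1 : numForm A ζ x ≤ numForm A ζ y := hmax ⟨hx, hg⟩
        have h2 := hC' η x
        have hx1 : ‖x‖ = 1 := by simpa using hx.1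
        rw [hx1] at h2
        have h3 : -numForm A η x ≤ D := by
          have := neg_abs_le (numForm A η x)
          nlinarith
        have h4 : -numForm A ζ y / (2 * D) * D = -numForm A ζ y / 2 := by
          field_simp
        nlinarith [mul_le_mul_of_nonneg_left h3 hδ.le]
      · push Not at hg
        nlinarith [h x hx.2, mul_pos hδ hg]
  obtain ⟨δ, hδ, hδ'⟩ := key
  refine ⟨δ, hδ, fun x hx hx0 => ?_⟩
  have e : ∀ z, numForm A (ζ - δ * η) z = numForm A ζ z - δ * numForm A η z := fun z => by
    rw [sub_eq_add_neg, numForm_add_left, numForm_neg_left, numForm_real_mul]; ring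
  have hmem : ((‖x‖⁻¹ : ℝ) : ℂ) • x ∈ Metric.sphere (0 : E) 1 ∩ V :=
    ⟨by simp [norm_smul, hx0], V.smul_mem _ hx⟩
  have h1 := hδ' _ hmem
  rw [← e, numForm_smul] at h1
  have hpos : 0 < ‖((‖x‖⁻¹ : ℝ) : ℂ)‖ ^ 2 := by
    have : 0 < ‖x‖ := norm_pos_iff.mpr hx0
    simp only [Complex.norm_real, norm_inv, norm_norm]
    positivity
  by_contra hcon
  push Not at hcon
  nlinarith [mul_nonneg hpos.le hcon]

end QuadraticForms

/-! ### Splitting off an isotropic eigenvector of the pencil. -/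

section IsotropicSubspaces

set_option linter.unusedSectionVars false

open scoped ComplexConjugate InnerProductSpace
open Module

universe u

variable {E : Type u} [NormedAddCommGroup E] [InnerProductSpace ℂ E] [FiniteDimensional ℂ E]

/-- For every `ζ ≠ 0` the form `Re (ζ ⟪x, A x⟫)` is nonnegative on a subspace of dimension at
least `k`. -/
def HasNonnegIndex (k : ℕ) (A : E →ₗ[ℂ] E) : Prop :=
  ∀ ζ : ℂ, ζ ≠ 0 → ∃ P : Submodule ℂ E, k ≤ finrank ℂ P ∧ ∀ x ∈ P, 0 ≤ numForm A ζ x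

/-- No isotropic vector `u` is an eigenvector of the pencil spanned by `A` and its adjoint. -/
def NoIsotropicEigenvector (A : E →ₗ[ℂ] E) : Prop :=
  ∀ u : E, u ≠ 0 → inner ℂ u (A u) = 0 →
    ∀ α β : ℂ, α • A u + β • LinearMap.adjoint A u = 0 → α = 0 ∧ β = 0

/-- The compression of `A` to `W`. -/
noncomputable def LinearMap.compress (A : E →ₗ[ℂ] E) (W : Submodule ℂ E) : W →ₗ[ℂ] W :=
  W.orthogonalProjectionOnto.toLinearMap ∘ₗ A ∘ₗ W.subtype

theorem LinearMap.inner_compress (A : E →ₗ[ℂ] E) (W : Submodule ℂ E) (x y : W) :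
    inner ℂ x (A.compress W y) = inner ℂ (x : E) (A y) := by
  simp [LinearMap.compress]

theorem numForm_compress (A : E →ₗ[ℂ] E) (W : Submodule ℂ E) (ζ : ℂ) (x : W) :
    numForm (A.compress W) ζ x = numForm A ζ x := by
  rw [numForm, LinearMap.inner_compress, numForm]

/-- Having `k` nonnegative directions is a closed condition: otherwise the form would be negative
with a uniform margin on a subspace meeting every `P` of dimension `k`. -/
theorem exists_nonneg_of_approx (A : E →ₗ[ℂ] E) (ζ : ℂ) (k : ℕ)
    (h : ∀ δ : ℝ, 0 < δ → ∃ P : Submodule ℂ E, k ≤ finrank ℂ P ∧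
      ∀ x ∈ P, -δ * ‖x‖ ^ 2 ≤ numForm A ζ x) :
    ∃ P : Submodule ℂ E, k ≤ finrank ℂ P ∧ ∀ x ∈ P, 0 ≤ numForm A ζ x := by
  rcases exists_nonneg_or_neg_numForm A ζ k with h1 | ⟨V, hV, hneg⟩
  · exact h1
  · exfalso
    obtain ⟨ε, hε, hb⟩ := exists_neg_bound_numForm A ζ V hneg
    obtain ⟨P, hP, hP'⟩ := h (ε / 2) (by positivity)
    obtain ⟨x, hxP, hxV, hx0⟩ := Submodule.exists_ne_zero_mem_inf (P := P) (V := V) (by omega)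
    have h1 := hP' x hxP
    have h2 := hb x hxV
    have : 0 < ‖x‖ ^ 2 := by positivity
    nlinarith

theorem Submodule.finrank_le_finrank_inf_orthogonal_singleton (S : Submodule ℂ E) (v : E) :
    finrank ℂ S ≤ finrank ℂ (S ⊓ (ℂ ∙ v)ᗮ : Submodule ℂ E) + 1 := by
  have h1 := Submodule.finrank_sup_add_finrank_inf_eq S (ℂ ∙ v)ᗮ
  have h2 := Submodule.finrank_add_finrank_orthogonal (ℂ ∙ v)
  have h3 := Submodule.finrank_le (S ⊔ (ℂ ∙ v)ᗮ)
  have h4 : finrank ℂ (ℂ ∙ v) ≤ 1 := by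
    simpa using finrank_span_le_card (R := ℂ) ({v} : Set E)
  omega

/-- A semidefinite form vanishes on the pairs `(x, u)` with `u` isotropic. -/
theorem inner_hermPart_eq_zero_of_nonneg (A : E →ₗ[ℂ] E) (ζ : ℂ) (P : Submodule ℂ E)
    (hP : ∀ x ∈ P, 0 ≤ numForm A ζ x) {u x : E} (hu : u ∈ P) (hx : x ∈ P)
    (hq : numForm A ζ u = 0) : inner ℂ x (hermPart A ζ u) = 0 := by
  by_contra hne
  set c := inner ℂ x (hermPart A ζ u) with hc
  have hsymm : inner ℂ u (hermPart A ζ x) = conj c := by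
    rw [← hermPart_isSymmetric A ζ u x, ← inner_conj_symm, hc]
  -- Along `x - t c̄ u` the form is affine in `t`, as `u` is null, so it could not stay nonnegative
  -- if `c ≠ 0`.
  have key : ∀ t : ℝ, 0 ≤ 2 * numForm A ζ x - 2 * t * ‖c‖ ^ 2 := by
    intro t
    have h1 := hP (x - ((t : ℂ) * conj c) • u) (P.sub_mem hx (P.smul_mem _ hu))
    have h2 := inner_hermPart_self A ζ (x - ((t : ℂ) * conj c) • u)
    simp only [map_sub, map_smul, inner_sub_left, inner_sub_right, inner_smul_left,
      inner_smul_right, hsymm, ← hc, inner_hermPart_self, hq] at h2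
    have h3 := congrArg Complex.re h2
    have h4 := Complex.mul_conj' c
    have h5 : conj c * c = (‖c‖ : ℂ) ^ 2 := Complex.conj_mul' c
    have e1 : (t : ℂ) * conj c * c = ((t * ‖c‖ ^ 2 : ℝ) : ℂ) := by
      push_cast; rw [mul_assoc, h5]
    have e2 : conj ((t : ℂ) * conj c) * conj c = ((t * ‖c‖ ^ 2 : ℝ) : ℂ) := by
      push_cast; rw [map_mul, Complex.conj_ofReal, Complex.conj_conj, mul_assoc, h4]
    rw [mul_zero, Complex.ofReal_zero, mul_zero, sub_zero, e1, e2] at h3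
    simp only [Complex.sub_re, Complex.ofReal_re] at h3
    linarith
  have hcpos : 0 < ‖c‖ ^ 2 := by positivity
  have := key ((numForm A ζ x + 1) / ‖c‖ ^ 2)
  have e : 2 * ((numForm A ζ x + 1) / ‖c‖ ^ 2) * ‖c‖ ^ 2 = 2 * (numForm A ζ x + 1) := by
    field_simp
  linarith

/-- The vectors orthogonal to `u`, `A u` and `A* u`. -/
noncomputable def isotropicReduction (A : E →ₗ[ℂ] E) (u : E) : Submodule ℂ E :=
  (ℂ ∙ u)ᗮ ⊓ ((ℂ ∙ A u)ᗮ ⊓ (ℂ ∙ LinearMap.adjoint A u)ᗮ)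

theorem mem_isotropicReduction {A : E →ₗ[ℂ] E} {u x : E} :
    x ∈ isotropicReduction A u ↔
      inner ℂ u x = 0 ∧ inner ℂ (A u) x = 0 ∧ inner ℂ (LinearMap.adjoint A u) x = 0 := by
  simp [isotropicReduction, Submodule.mem_orthogonal_singleton_iff_inner_right]

theorem finrank_isotropicReduction_lt (A : E →ₗ[ℂ] E) {u : E} (hu : u ≠ 0) :
    finrank ℂ (isotropicReduction A u) < finrank ℂ E := by
  refine Submodule.finrank_lt fun h => hu ?_
  have : u ∈ isotropicReduction A u := h ▸ Submodule.mem_top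
  exact inner_self_eq_zero.mp (mem_isotropicReduction.mp this).1

/-- Only one dimension is lost. If `u ∈ P`, semidefiniteness already puts `P` in the complement of
`hermPart A ζ u`, and only the condition `x ⊥ u` costs. If `u ∉ P`, adjoining `u` gains one
dimension before the two orthogonality conditions are imposed, and does not affect the values of the
form on the resulting subspace. -/
theorem exists_nonneg_le_isotropicReduction (A : E →ₗ[ℂ] E) {k : ℕ} {u : E}
    (hq : inner ℂ u (A u) = 0) {ζ : ℂ}
    (hA : A u ∈ ℂ ∙ hermPart A ζ u) (hA' : LinearMap.adjoint A u ∈ ℂ ∙ hermPart A ζ u)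
    (hP : ∃ P : Submodule ℂ E, k + 1 ≤ finrank ℂ P ∧ ∀ x ∈ P, 0 ≤ numForm A ζ x) :
    ∃ P : Submodule ℂ E, P ≤ isotropicReduction A u ∧ k ≤ finrank ℂ P ∧
      ∀ x ∈ P, 0 ≤ numForm A ζ x := by
  obtain ⟨P, hk, hP⟩ := hP
  have hqu : numForm A ζ u = 0 := by simp [numForm, hq]
  refine ⟨(P ⊔ ℂ ∙ u) ⊓ (ℂ ∙ hermPart A ζ u)ᗮ ⊓ (ℂ ∙ u)ᗮ, ?_, ?_, ?_⟩
  · rintro x ⟨⟨-, hx⟩, hxu⟩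
    rw [SetLike.mem_coe, Submodule.mem_orthogonal_singleton_iff_inner_right] at hxu
    exact mem_isotropicReduction.mpr ⟨hxu, hx _ hA, hx _ hA'⟩
  · have h1 := Submodule.finrank_le_finrank_inf_orthogonal_singleton
      ((P ⊔ ℂ ∙ u) ⊓ (ℂ ∙ hermPart A ζ u)ᗮ) u
    by_cases huP : u ∈ P
    · have e : P ≤ (P ⊔ ℂ ∙ u) ⊓ (ℂ ∙ hermPart A ζ u)ᗮ := by
        refine le_inf le_sup_left fun x hx => ?_
        rw [Submodule.mem_orthogonal_singleton_iff_inner_left]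
        exact inner_hermPart_eq_zero_of_nonneg A ζ P hP huP hx hqu
      have := Submodule.finrank_mono e
      omega
    · have h2 := Submodule.finrank_le_finrank_inf_orthogonal_singleton (P ⊔ ℂ ∙ u)
        (hermPart A ζ u)
      have h3 := Submodule.finrank_sup_span_singleton huP
      omega
  · rintro x ⟨⟨hx, hxH⟩, -⟩
    obtain ⟨p, hp, v, hv, rfl⟩ := Submodule.mem_sup.mp hx
    obtain ⟨c, rfl⟩ := Submodule.mem_span_singleton.mp hv
    rw [SetLike.mem_coe, Submodule.mem_orthogonal_singleton_iff_inner_left, inner_add_left,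
      inner_smul_left, inner_hermPart_self, hqu] at hxH
    have h0 : inner ℂ p (hermPart A ζ (c • u)) = 0 := by
      rw [map_smul, inner_smul_right]
      simp only [mul_zero, Complex.ofReal_zero, add_zero] at hxH
      rw [hxH, mul_zero]
    rw [numForm_add_of_hermPart_orthogonal A ζ _ _ h0, numForm_smul, hqu]
    simpa using hP p hp

theorem exists_nonneg_compress {A : E →ₗ[ℂ] E} {W P : Submodule ℂ E} (hPW : P ≤ W) {ζ : ℂ} {c : ℝ}
    (h : ∀ x ∈ P, c * ‖x‖ ^ 2 ≤ numForm A ζ x) :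
    ∃ P' : Submodule ℂ W, finrank ℂ P' = finrank ℂ P ∧
      ∀ x ∈ P', c * ‖x‖ ^ 2 ≤ numForm (A.compress W) ζ x :=
  ⟨P.comap W.subtype, (Submodule.comapSubtypeEquivOfLe hPW).finrank_eq, fun x hx => by
    rw [numForm_compress]; exact h x hx⟩

/-- Dependence puts `A u` and `A* u` on one line `ℂ y`, and `hermPart A ζ u` is a multiple of `y`.
When that multiple is nonzero, or when both vectors vanish, the preceding reduction applies; the
remaining `ζ` are limits of good ones. -/
theorem HasNonnegIndex.compress_isotropicReduction {A : E →ₗ[ℂ] E} {k : ℕ}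
    (h : HasNonnegIndex (k + 1) A) {u : E} (hq : inner ℂ u (A u) = 0) {α β : ℂ}
    (hαβ : ¬(α = 0 ∧ β = 0)) (hdep : α • A u + β • LinearMap.adjoint A u = 0) :
    HasNonnegIndex k (A.compress (isotropicReduction A u)) := by
  obtain ⟨y, a, b, ha, hb⟩ : ∃ (y : E) (a b : ℂ), A u = a • y ∧ LinearMap.adjoint A u = b • y := by
    by_cases hα : α = 0
    · have hβ : β ≠ 0 := fun hβ => hαβ ⟨hα, hβ⟩
      refine ⟨A u, 1, 0, (one_smul _ _).symm, ?_⟩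
      rw [hα, zero_smul, zero_add] at hdep
      rw [zero_smul]
      exact (smul_eq_zero.mp hdep).resolve_left hβ
    · refine ⟨LinearMap.adjoint A u, -(α⁻¹ * β), 1, ?_, (one_smul _ _).symm⟩
      have := congrArg (fun v => α⁻¹ • v) hdep
      simp only [smul_add, smul_smul, inv_mul_cancel₀ hα, one_smul, smul_zero] at this
      rw [neg_smul]
      exact eq_neg_of_add_eq_zero_left this
  have hH : ∀ ζ : ℂ, hermPart A ζ u = (ζ * a + conj ζ * b) • y := fun ζ => by
    simp only [hermPart, LinearMap.add_apply, LinearMap.smul_apply, ha, hb, smul_smul, add_smul]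
  have main : ∀ ζ : ℂ, ζ ≠ 0 → ζ * a + conj ζ * b ≠ 0 →
      ∃ P : Submodule ℂ E, P ≤ isotropicReduction A u ∧ k ≤ finrank ℂ P ∧
        ∀ x ∈ P, 0 ≤ numForm A ζ x := by
    intro ζ hζ hne
    have hy : y ∈ ℂ ∙ hermPart A ζ u := by
      rw [Submodule.mem_span_singleton, hH]
      exact ⟨(ζ * a + conj ζ * b)⁻¹, by rw [smul_smul, inv_mul_cancel₀ hne, one_smul]⟩
    refine exists_nonneg_le_isotropicReduction A hq ?_ ?_ (h ζ hζ)
    · rw [ha]; exact Submodule.smul_mem _ _ hy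
    · rw [hb]; exact Submodule.smul_mem _ _ hy
  intro ζ hζ
  by_cases hne : ζ * a + conj ζ * b = 0
  · by_cases ha0 : a = 0
    · have hb0 : b = 0 := by
        rw [ha0, mul_zero, zero_add, mul_eq_zero] at hne
        exact hne.resolve_left (by simpa using hζ)
      rw [ha0, zero_smul] at ha
      rw [hb0, zero_smul] at hb
      obtain ⟨P, hPW, hk, hP⟩ := exists_nonneg_le_isotropicReduction A (k := k) hq (ζ := ζ)
        (by rw [ha]; exact Submodule.zero_mem _) (by rw [hb]; exact Submodule.zero_mem _) (h ζ hζ)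
      obtain ⟨P', hf, hP'⟩ := exists_nonneg_compress (A := A) hPW (ζ := ζ) (c := 0)
        (by simpa using hP)
      exact ⟨P', hf ▸ hk, by simpa using hP'⟩
    · apply exists_nonneg_of_approx
      intro δ hδ
      obtain ⟨C, hC, hbound⟩ := exists_numForm_bound A
      have hn : 0 < ‖ζ‖ := norm_pos_iff.mpr hζ
      -- Rotating `ζ` towards `iζ` makes the coefficient of `y` nonzero; this `τ` gives `‖η‖ C = δ`,
      -- so the form changes by at most `δ ‖x‖²`.
      set τ : ℝ := δ / (‖ζ‖ * C) with hτ
      have hτ0 : 0 < τ := by positivity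
      set η : ℂ := τ * (Complex.I * ζ) with hη
      have hηne : ζ + η ≠ 0 := by
        have e : ζ + η = ζ * (1 + τ * Complex.I) := by rw [hη]; ring
        rw [e]
        refine mul_ne_zero hζ fun h0 => ?_
        have := congrArg Complex.re h0
        simp at this
      have hne' : (ζ + η) * a + conj (ζ + η) * b ≠ 0 := by
        have e : (ζ + η) * a + conj (ζ + η) * b = 2 * τ * Complex.I * (ζ * a) := by
          have : conj (ζ + η) = conj ζ - τ * Complex.I * conj ζ := by
            rw [hη]; simp; ring
          rw [this, hη]
          linear_combination (1 - τ * Complex.I) * hne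
        rw [e]
        refine mul_ne_zero (mul_ne_zero (mul_ne_zero two_ne_zero ?_) Complex.I_ne_zero)
          (mul_ne_zero hζ ha0)
        exact_mod_cast hτ0.ne'
      obtain ⟨P, hPW, hk, hP⟩ := main _ hηne hne'
      have hP'' : ∀ x ∈ P, -δ * ‖x‖ ^ 2 ≤ numForm A ζ x := by
        intro x hx
        have h1 := hP x hx
        rw [numForm_add_left] at h1
        have h2 := hbound η x
        have h3 : ‖η‖ * C = δ := by
          rw [hη, norm_mul, norm_mul, Complex.norm_real, Complex.norm_I, one_mul,
            Real.norm_of_nonneg hτ0.le, hτ]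
          field_simp
        rw [h3] at h2
        linarith [le_abs_self (numForm A η x)]
      obtain ⟨P', hf, hP'⟩ := exists_nonneg_compress hPW hP''
      exact ⟨P', hf ▸ hk, hP'⟩
  · obtain ⟨P, hPW, hk, hP⟩ := main ζ hζ hne
    obtain ⟨P', hf, hP'⟩ := exists_nonneg_compress (A := A) hPW (ζ := ζ) (c := 0)
      (by simpa using hP)
    exact ⟨P', hf ▸ hk, by simpa using hP'⟩

/-- Orthogonality to `A u` and `A* u` kills the cross terms when `u` is added back, and
orthogonality to `u` makes the sum direct. -/
theorem exists_isotropic_of_isotropicReduction {A : E →ₗ[ℂ] E} {k : ℕ} {u : E} (hu : u ≠ 0)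
    (hq : inner ℂ u (A u) = 0)
    (h : ∃ L : Submodule ℂ (isotropicReduction A u), finrank ℂ L = k ∧
      ∀ x ∈ L, inner ℂ x (A.compress _ x) = 0) :
    ∃ L : Submodule ℂ E, finrank ℂ L = k + 1 ∧ ∀ x ∈ L, inner ℂ x (A x) = 0 := by
  obtain ⟨L, hL, hL0⟩ := h
  refine ⟨L.map (isotropicReduction A u).subtype ⊔ ℂ ∙ u, ?_, ?_⟩
  · rw [Submodule.finrank_sup_span_singleton, Submodule.finrank_map_subtype_eq, hL]
    rintro ⟨x, -, hx⟩
    have := (mem_isotropicReduction.mp x.2).1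
    rw [Submodule.subtype_apply] at hx
    rw [hx] at this
    exact hu (inner_self_eq_zero.mp this)
  · intro z hz
    obtain ⟨p, hp, v, hv, rfl⟩ := Submodule.mem_sup.mp hz
    obtain ⟨c, rfl⟩ := Submodule.mem_span_singleton.mp hv
    obtain ⟨x, hx, rfl⟩ := hp
    have h1 := hL0 x hx
    rw [LinearMap.inner_compress] at h1
    obtain ⟨-, h2, h3⟩ := mem_isotropicReduction.mp x.2
    have h2' : inner ℂ (x : E) (A u) = 0 := by rw [← inner_conj_symm, h2, map_zero]
    rw [LinearMap.adjoint_inner_left] at h3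
    simp only [map_add, map_smul, inner_add_left, inner_add_right, inner_smul_left,
      inner_smul_right, Submodule.subtype_apply, h1, h2', h3, hq, mul_zero, add_zero]

end IsotropicSubspaces

/-! ### The Li–Sze theorem. -/

section IsotropicExistence

set_option linter.unusedSectionVars false

open scoped ComplexConjugate InnerProductSpace
open Module

universe u

variable {E : Type u} [NormedAddCommGroup E] [InnerProductSpace ℂ E] [FiniteDimensional ℂ E]

/-- If a form takes both signs on a complex subspace, it has an isotropic vector there. -/
theorem exists_numForm_eq_zero (A : E →ₗ[ℂ] E) (η : ℂ) {K : Submodule ℂ E} {x y : E} (hx : x ∈ K)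
    (hy : y ∈ K) (hx' : 0 < numForm A η x) (hy' : numForm A η y < 0) :
    ∃ z ∈ K, z ≠ 0 ∧ numForm A η z = 0 := by
  have hcont : Continuous fun s : ℝ => numForm A η ((((1 - s : ℝ) : ℂ)) • x + (s : ℂ) • y) :=
    (continuous_numForm A η).comp (by fun_prop)
  have h0 : (0 : ℝ) ∈ Set.Icc (numForm A η ((((1 - 1 : ℝ) : ℂ)) • x + ((1 : ℝ) : ℂ) • y))
      (numForm A η ((((1 - 0 : ℝ) : ℂ)) • x + ((0 : ℝ) : ℂ) • y)) := by
    simp [hx'.le, hy'.le]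
  obtain ⟨s, -, hs⟩ := intermediate_value_Icc' zero_le_one hcont.continuousOn h0
  -- The combination is nonzero: proportional vectors cannot give the form opposite signs, because
  -- scaling multiplies it by `‖c‖²`.
  refine ⟨_, K.add_mem (K.smul_mem _ hx) (K.smul_mem _ hy), fun hz => ?_, hs⟩
  have e : ((1 - s : ℝ) : ℂ) • x = ((-s : ℝ) : ℂ) • y := by
    rw [eq_neg_of_add_eq_zero_left hz]; push_cast; rw [neg_smul]
  have h1 := congrArg (numForm A η) e
  rw [numForm_smul, numForm_smul, Complex.norm_real, Complex.norm_real] at h1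
  have h2 : 0 ≤ ‖(1 - s : ℝ)‖ ^ 2 * numForm A η x := by positivity
  have h3 : ‖(-s : ℝ)‖ ^ 2 * numForm A η y ≤ 0 :=
    mul_nonpos_of_nonneg_of_nonpos (by positivity) hy'.le
  have h4 : ‖(1 - s : ℝ)‖ ^ 2 = 0 := by
    have : ‖(1 - s : ℝ)‖ ^ 2 * numForm A η x = 0 := le_antisymm (h1 ▸ h3) h2
    exact (mul_eq_zero.mp this).resolve_right hx'.ne'
  have h5 : ‖(-s : ℝ)‖ ^ 2 = 0 := by
    have : ‖(-s : ℝ)‖ ^ 2 * numForm A η y = 0 := le_antisymm h3 (h1 ▸ h2)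
    exact (mul_eq_zero.mp this).resolve_right hy'.ne
  have h6 : 1 - s = 0 := by simpa using h4
  have h7 : s = 0 := by simpa using h5
  linarith

/-- Otherwise the `ζ`-form is nonpositive on a large `V`, with null vectors in the kernel of
`hermPart A ζ`. On that kernel the `iζ`-form has no nontrivial zeros, hence one sign, so a slight
rotation of `ζ` makes the form negative definite on `V`, against the index hypothesis. -/
theorem HasNonnegIndex.exists_pos {A : E →ₗ[ℂ] E} {k : ℕ} (h : HasNonnegIndex k A)
    (hA : NoIsotropicEigenvector A) {ζ : ℂ} (hζ : ζ ≠ 0) :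
    ∃ P : Submodule ℂ E, k ≤ finrank ℂ P ∧ ∀ x ∈ P, x ≠ 0 → 0 < numForm A ζ x := by
  rcases exists_pos_or_nonpos_numForm A ζ k with h1 | ⟨V, hV, hVneg⟩
  · exact h1
  exfalso
  have hker : ∀ x, x ≠ 0 → hermPart A ζ x = 0 → numForm A (Complex.I * ζ) x ≠ 0 := by
    intro x hx0 hx hI
    have h1 : numForm A ζ x = 0 := by
      have := inner_hermPart_re A ζ x
      rw [hx, inner_zero_right, Complex.zero_re] at this
      linarith
    have h2 : ζ * inner ℂ x (A x) = 0 := by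
      apply Complex.ext
      · exact h1
      · rw [numForm, mul_assoc, Complex.I_mul_re] at hI
        exact neg_eq_zero.mp hI
    exact hζ (hA x hx0 ((mul_eq_zero.mp h2).resolve_left hζ) ζ (conj ζ)
      (by simpa [hermPart] using hx)).1
  have hsign : ∃ σ : ℝ, ∀ x ∈ V, x ≠ 0 → numForm A ζ x = 0 →
      0 < numForm A (σ * (Complex.I * ζ)) x := by
    by_cases hpos : ∃ x, x ≠ 0 ∧ hermPart A ζ x = 0 ∧ 0 < numForm A (Complex.I * ζ) x
    · obtain ⟨x, hx0, hx, hxpos⟩ := hpos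
      refine ⟨1, fun y hy hy0 hy1 => ?_⟩
      have hyk := (hVneg y hy).2 hy1
      rw [Complex.ofReal_one, one_mul]
      by_contra hcon
      obtain ⟨z, hz, hz0, hz1⟩ := exists_numForm_eq_zero A (Complex.I * ζ)
        (K := LinearMap.ker (hermPart A ζ)) hx hyk hxpos
        (lt_of_le_of_ne (not_lt.mp hcon) (hker y hy0 hyk))
      exact hker z hz0 hz hz1
    · push Not at hpos
      refine ⟨-1, fun y hy hy0 hy1 => ?_⟩
      have hyk := (hVneg y hy).2 hy1
      rw [numForm_real_mul]
      have := lt_of_le_of_ne (hpos y hy0 hyk) (hker y hy0 hyk)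
      linarith
  obtain ⟨σ, hσ⟩ := hsign
  obtain ⟨δ, hδ, hneg⟩ := exists_perturbation_neg A ζ (σ * (Complex.I * ζ)) V
    (fun x hx => (hVneg x hx).1) hσ
  have hne : ζ - δ * (σ * (Complex.I * ζ)) ≠ 0 := by
    have e : ζ - δ * (σ * (Complex.I * ζ)) = ζ * (1 - ((δ * σ : ℝ) : ℂ) * Complex.I) := by
      push_cast; ring
    rw [e]
    refine mul_ne_zero hζ fun h0 => ?_
    have := congrArg Complex.re h0
    rw [Complex.sub_re, Complex.re_ofReal_mul] at this
    simp at this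
  obtain ⟨P, hP, hPpos⟩ := h _ hne
  obtain ⟨x, hxP, hxV, hx0⟩ := Submodule.exists_ne_zero_mem_inf (P := P) (V := V) (by omega)
  exact absurd (hPpos x hxP) (not_le.mpr (hneg x hxV hx0))

/-- Some `hermPart A ζ` with `ζ ≠ 0` is singular, while the `ζ`-form has `k` positive and `k`
negative directions. The kernel supplies one more dimension. -/
theorem HasNonnegIndex.two_mul_lt_finrank {A : E →ₗ[ℂ] E} {k : ℕ} (h : HasNonnegIndex k A)
    (hA : NoIsotropicEigenvector A) (hE : 0 < finrank ℂ E) : 2 * k < finrank ℂ E := by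
  have hinj : Function.Injective A := by
    rw [← LinearMap.ker_eq_bot, LinearMap.ker_eq_bot']
    intro u hu
    by_contra hu0
    have := hA u hu0 (by rw [hu, inner_zero_right]) 1 0 (by simp [hu])
    exact one_ne_zero this.1
  have := Module.finrank_pos_iff.mp hE
  -- An eigenvector of `A⁻¹ A*` satisfies `A* u = μ A u`.
  obtain ⟨μ, hμ⟩ := Module.End.exists_eigenvalue
    ((LinearEquiv.ofInjectiveEndo A hinj).symm.toLinearMap ∘ₗ LinearMap.adjoint A)
  obtain ⟨u, hu⟩ := hμ.exists_hasEigenvector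
  have hu0 := hu.2
  have hAu : LinearMap.adjoint A u = μ • A u := by
    have h1 := hu.apply_eq_smul
    have h2 := congrArg A h1
    rw [map_smul, LinearMap.comp_apply] at h2
    rw [← h2]
    exact ((LinearEquiv.ofInjectiveEndo A hinj).apply_symm_apply _).symm
  set q := inner ℂ u (A u) with hq
  have hqμ : conj q = μ * q := by
    rw [hq, inner_conj_symm, ← LinearMap.adjoint_inner_right, hAu, inner_smul_right]
  have hq0 : q ≠ 0 := fun h0 =>
    one_ne_zero (neg_eq_zero.mp (hA u hu0 h0 μ (-1) (by rw [hAu, neg_smul, one_smul, add_neg_cancel])).2)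
  -- From `q̄ = μ q` this choice gives `ζ + ζ̄ μ = 0`, so `u` is in the kernel of `hermPart A ζ`.
  set ζ := Complex.I * conj q with hζ
  have hζ0 : ζ ≠ 0 := mul_ne_zero Complex.I_ne_zero (by simpa using hq0)
  have hH : hermPart A ζ u = 0 := by
    have e : ζ + conj ζ * μ = 0 := by
      have : conj ζ = -(Complex.I * q) := by rw [hζ]; simp
      rw [this, hζ]
      linear_combination Complex.I * hqμ
    simp only [hermPart, LinearMap.add_apply, LinearMap.smul_apply, hAu, smul_smul]
    rw [← add_smul, e, zero_smul]
  have hu1 : numForm A ζ u = 0 := by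
    have := inner_hermPart_re A ζ u
    rw [hH, inner_zero_right, Complex.zero_re] at this
    linarith
  obtain ⟨P, hP, hPpos⟩ := h.exists_pos hA hζ0
  obtain ⟨V, hV, hVpos⟩ := h.exists_pos hA (neg_ne_zero.mpr hζ0)
  have huP : u ∉ P := fun huP => (hPpos u huP hu0).ne' hu1
  have h1 := Submodule.finrank_sup_span_singleton huP
  by_contra hcon
  obtain ⟨x, hxP, hxV, hx0⟩ := Submodule.exists_ne_zero_mem_inf (P := P ⊔ ℂ ∙ u) (V := V) (by omega)
  obtain ⟨p, hp, v, hv, rfl⟩ := Submodule.mem_sup.mp hxP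
  obtain ⟨c, rfl⟩ := Submodule.mem_span_singleton.mp hv
  have h2 := hVpos _ hxV hx0
  rw [numForm_neg_left, numForm_add_of_hermPart_orthogonal A ζ _ _
    (by rw [map_smul, hH, smul_zero, inner_zero_right]), numForm_smul, hu1] at h2
  rcases eq_or_ne p 0 with rfl | hp0
  · simp [numForm] at h2
  · linarith [hPpos p hp hp0]

theorem numForm_sub_smul_id (A : E →ₗ[ℂ] E) (t : ℝ) (ζ : ℂ) (x : E) :
    numForm (A - (t : ℂ) • LinearMap.id) ζ x = numForm A ζ x - t * ζ.re * ‖x‖ ^ 2 := by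
  have h : inner ℂ x x = ((‖x‖ ^ 2 : ℝ) : ℂ) := by
    rw [inner_self_eq_norm_sq_to_K]; norm_cast
  simp only [numForm, LinearMap.sub_apply, LinearMap.smul_apply, LinearMap.id_apply,
    inner_sub_right, inner_smul_right, mul_sub, Complex.sub_re, h]
  have : ζ * ((t : ℂ) * ((‖x‖ ^ 2 : ℝ) : ℂ)) = ((t * ‖x‖ ^ 2 : ℝ) : ℂ) * ζ := by push_cast; ring
  rw [this, Complex.re_ofReal_mul]
  ring

/-- A subspace on which the form is positive still works, with half the margin, for nearby `ζ`;
compactness of the unit circle makes the margin uniform. -/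
theorem HasNonnegIndex.exists_uniform_pos {A : E →ₗ[ℂ] E} {k : ℕ} (h : HasNonnegIndex k A)
    (hA : NoIsotropicEigenvector A) :
    ∃ ε : ℝ, 0 < ε ∧ ∀ ζ : ℂ, ‖ζ‖ = 1 → ∃ P : Submodule ℂ E, k ≤ finrank ℂ P ∧
      ∀ x ∈ P, ε * ‖x‖ ^ 2 ≤ numForm A ζ x := by
  obtain ⟨C, hC, hbound⟩ := exists_numForm_bound A
  have key : ∃ ε : ℝ, 0 < ε ∧ ∀ ζ ∈ Metric.sphere (0 : ℂ) 1, ∃ P : Submodule ℂ E,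
      k ≤ finrank ℂ P ∧ ∀ x ∈ P, ε * ‖x‖ ^ 2 ≤ numForm A ζ x := by
    refine (isCompact_sphere (0 : ℂ) 1).induction_on
      (p := fun s => ∃ ε : ℝ, 0 < ε ∧ ∀ ζ ∈ s, ∃ P : Submodule ℂ E,
        k ≤ finrank ℂ P ∧ ∀ x ∈ P, ε * ‖x‖ ^ 2 ≤ numForm A ζ x) ?_ ?_ ?_ ?_
    · exact ⟨1, one_pos, fun ζ hζ => hζ.elim⟩
    · rintro s t hst ⟨ε, hε, ht⟩
      exact ⟨ε, hε, fun ζ hζ => ht ζ (hst hζ)⟩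
    · rintro s t ⟨ε, hε, hs⟩ ⟨ε', hε', ht⟩
      refine ⟨min ε ε', lt_min hε hε', fun ζ hζ => ?_⟩
      rcases hζ with hζ | hζ
      · obtain ⟨P, hP, hP'⟩ := hs ζ hζ
        exact ⟨P, hP, fun x hx => le_trans (by gcongr; exact min_le_left _ _) (hP' x hx)⟩
      · obtain ⟨P, hP, hP'⟩ := ht ζ hζ
        exact ⟨P, hP, fun x hx => le_trans (by gcongr; exact min_le_right _ _) (hP' x hx)⟩
    · intro ζ hζ
      have hζ0 : ζ ≠ 0 := by
        rintro rfl
        simp at hζ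
      obtain ⟨P, hP, hPpos⟩ := h.exists_pos hA hζ0
      obtain ⟨ε, hε, hP'⟩ := exists_pos_bound_numForm A ζ P hPpos
      refine ⟨Metric.ball ζ (ε / (2 * C)) , mem_nhdsWithin_of_mem_nhds
        (Metric.ball_mem_nhds _ (by positivity)), ε / 2, by positivity, fun η hη => ⟨P, hP, ?_⟩⟩
      intro x hx
      have h1 := hP' x hx
      have h2 := hbound (η - ζ) x
      have h3 : numForm A η x = numForm A ζ x + numForm A (η - ζ) x := by
        rw [← numForm_add_left]; congr 1; ring
      rw [Metric.mem_ball, dist_eq_norm, lt_div_iff₀ (by positivity)] at hη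
      have h4 := neg_abs_le (numForm A (η - ζ) x)
      nlinarith [sq_nonneg ‖x‖]
  obtain ⟨ε, hε, hk⟩ := key
  exact ⟨ε, hε, fun ζ hζ => hk ζ (by simpa using hζ)⟩

/-- Translation of `A` along the real axis until an isotropic eigenvector appears. -/
theorem HasNonnegIndex.exists_shift {A : E →ₗ[ℂ] E} {k : ℕ} (h : HasNonnegIndex k A)
    (hk : 1 ≤ k) (hA : NoIsotropicEigenvector A) :
    ∃ t : ℝ, 0 < t ∧ HasNonnegIndex k (A - (t : ℂ) • LinearMap.id) ∧
      ¬ NoIsotropicEigenvector (A - (t : ℂ) • LinearMap.id) := by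
  obtain ⟨C, hC, hbound⟩ := exists_numForm_bound A
  -- The set of admissible shifts can be extended wherever there is no isotropic eigenvector: a
  -- shift by `ε` costs `ε Re ζ ‖x‖²`, at most the uniform margin. Its supremum is therefore the
  -- desired `t`.
  have hstep : ∀ s : ℝ, HasNonnegIndex k (A - (s : ℂ) • LinearMap.id) →
      NoIsotropicEigenvector (A - (s : ℂ) • LinearMap.id) →
      ∃ ε : ℝ, 0 < ε ∧ HasNonnegIndex k (A - ((s + ε : ℝ) : ℂ) • LinearMap.id) := by
    intro s hs hs'
    obtain ⟨ε, hε, hu⟩ := hs.exists_uniform_pos hs'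
    refine ⟨ε, hε, fun ζ hζ => ?_⟩
    have hn : 0 < ‖ζ‖ := norm_pos_iff.mpr hζ
    obtain ⟨P, hP, hP'⟩ := hu ((‖ζ‖⁻¹ : ℝ) * ζ) (by
      rw [norm_mul, Complex.norm_real, norm_inv, norm_norm, inv_mul_cancel₀ hn.ne'])
    refine ⟨P, hP, fun x hx => ?_⟩
    have h1 := hP' x hx
    rw [numForm_real_mul, numForm_sub_smul_id] at h1
    rw [numForm_sub_smul_id]
    have h2 : ζ.re ≤ ‖ζ‖ := Complex.re_le_norm ζ
    have h3 : ‖ζ‖ * (ε * ‖x‖ ^ 2) ≤ numForm A ζ x - s * ζ.re * ‖x‖ ^ 2 := by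
      calc ‖ζ‖ * (ε * ‖x‖ ^ 2) ≤ ‖ζ‖ * (‖ζ‖⁻¹ * (numForm A ζ x - s * ζ.re * ‖x‖ ^ 2)) := by gcongr
        _ = _ := by field_simp
    have h4 : ζ.re * (ε * ‖x‖ ^ 2) ≤ ‖ζ‖ * (ε * ‖x‖ ^ 2) := by gcongr
    nlinarith
  set S : Set ℝ := {t | HasNonnegIndex k (A - (t : ℂ) • LinearMap.id)} with hS
  have h0 : (0 : ℝ) ∈ S := by
    rw [hS, Set.mem_ofPred_eq]
    simpa using h
  have hbdd : BddAbove S := by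
    refine ⟨C, fun t ht => ?_⟩
    obtain ⟨P, hP, hP'⟩ := ht 1 one_ne_zero
    have hPne : P ≠ ⊥ := by
      rintro rfl
      rw [finrank_bot] at hP
      omega
    obtain ⟨x, hx, hx0⟩ := Submodule.exists_mem_ne_zero_of_ne_bot hPne
    have h1 := hP' x hx
    rw [numForm_sub_smul_id, Complex.one_re] at h1
    have h2 := hbound 1 x
    rw [norm_one] at h2
    have h3 : 0 < ‖x‖ ^ 2 := by positivity
    have h4 := le_abs_self (numForm A 1 x)
    by_contra hcon
    push Not at hcon
    nlinarith
  have hmem : sSup S ∈ S := by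
    intro ζ hζ
    apply exists_nonneg_of_approx
    intro δ hδ
    have hn : 0 < ‖ζ‖ := norm_pos_iff.mpr hζ
    obtain ⟨t, ht, ht'⟩ := exists_lt_of_lt_csSup ⟨0, h0⟩
      (show sSup S - δ / ‖ζ‖ < sSup S from sub_lt_self _ (by positivity))
    have ht'' := le_csSup hbdd ht
    obtain ⟨P, hP, hP'⟩ := ht ζ hζ
    refine ⟨P, hP, fun x hx => ?_⟩
    have h1 := hP' x hx
    rw [numForm_sub_smul_id] at h1 ⊢
    have h2 : (sSup S - t) * ζ.re ≤ δ := by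
      calc (sSup S - t) * ζ.re ≤ (sSup S - t) * ‖ζ‖ := by
            exact mul_le_mul_of_nonneg_left (Complex.re_le_norm ζ) (by linarith)
        _ ≤ δ / ‖ζ‖ * ‖ζ‖ := by gcongr; linarith
        _ = δ := by field_simp
    nlinarith [sq_nonneg ‖x‖]
  have hmax : ¬ NoIsotropicEigenvector (A - ((sSup S : ℝ) : ℂ) • LinearMap.id) := by
    intro hno
    obtain ⟨ε, hε, hε'⟩ := hstep _ hmem hno
    have := le_csSup hbdd hε'
    linarith
  refine ⟨sSup S, ?_, hmem, hmax⟩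
  refine lt_of_le_of_ne (le_csSup hbdd h0) fun he => hmax ?_
  rw [← he]
  simpa using hA

theorem HasNonnegIndex.neg {A : E →ₗ[ℂ] E} {k : ℕ} (h : HasNonnegIndex k A) :
    HasNonnegIndex k (-A) := by
  intro ζ hζ
  obtain ⟨P, hP, hP'⟩ := h (-ζ) (neg_ne_zero.mpr hζ)
  refine ⟨P, hP, fun x hx => ?_⟩
  have := hP' x hx
  simpa [numForm] using this

theorem NoIsotropicEigenvector.neg {A : E →ₗ[ℂ] E} (h : NoIsotropicEigenvector A) :
    NoIsotropicEigenvector (-A) := by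
  intro u hu hq α β hαβ
  have := h u hu (by simpa using hq) (-α) (-β) (by simpa using hαβ)
  simpa using this

/-- **Li–Sze theorem.** If for each `ζ ≠ 0` the form `Re (ζ ⟪x, A x⟫)` is nonnegative on a
subspace of dimension at least `k`, then `⟪x, A x⟫` vanishes on a subspace of dimension `k`. -/
theorem HasNonnegIndex.exists_isotropic (n : ℕ) : ∀ (E : Type u) [NormedAddCommGroup E]
    [InnerProductSpace ℂ E] [FiniteDimensional ℂ E], finrank ℂ E = n →
    ∀ (A : E →ₗ[ℂ] E) (k : ℕ), HasNonnegIndex k A →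
      ∃ L : Submodule ℂ E, finrank ℂ L = k ∧ ∀ x ∈ L, inner ℂ x (A x) = 0 := by
  induction n using Nat.strong_induction_on with
  | _ n IH =>
    intro E _ _ _ hn A k hA
    rcases Nat.eq_zero_or_pos k with rfl | hk
    · exact ⟨⊥, finrank_bot _ _, fun x hx => by simp [(Submodule.mem_bot ℂ).mp hx]⟩
    obtain ⟨j, rfl⟩ : ∃ j, k = j + 1 := ⟨k - 1, by omega⟩
    have case1 : ∀ B : E →ₗ[ℂ] E, HasNonnegIndex (j + 1) B → ¬ NoIsotropicEigenvector B →
        ∃ L : Submodule ℂ E, finrank ℂ L = j + 1 ∧ ∀ x ∈ L, inner ℂ x (B x) = 0 := by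
      intro B hB hno
      simp only [NoIsotropicEigenvector, not_forall] at hno
      obtain ⟨u, hu, hq, α, β, hdep, hαβ⟩ := hno
      exact exists_isotropic_of_isotropicReduction hu hq
        (IH _ (hn ▸ finrank_isotropicReduction_lt B hu) _ rfl _ j
          (hB.compress_isotropicReduction hq hαβ hdep))
    by_cases hno : NoIsotropicEigenvector A
    · have hself : ∀ x : E, inner ℂ x x = ((‖x‖ ^ 2 : ℝ) : ℂ) := fun x => by
        rw [inner_self_eq_norm_sq_to_K]; norm_cast
      -- Applied to `A` and to `-A`, this gives subspaces `L` and `M` where the form is `t ‖x‖²` and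
      -- `-s ‖x‖²`, with `t, s > 0`.
      have side : ∀ B : E →ₗ[ℂ] E, HasNonnegIndex (j + 1) B → NoIsotropicEigenvector B →
          ∃ (t : ℝ) (L : Submodule ℂ E), 0 < t ∧ finrank ℂ L = j + 1 ∧
            ∀ x ∈ L, inner ℂ x (B x) = ((t * ‖x‖ ^ 2 : ℝ) : ℂ) := by
        intro B hB hBno
        obtain ⟨t, ht, h1, h2⟩ := hB.exists_shift hk hBno
        obtain ⟨L, hL, hL'⟩ := case1 _ h1 h2
        refine ⟨t, L, ht, hL, fun x hx => ?_⟩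
        have := hL' x hx
        rw [LinearMap.sub_apply, inner_sub_right, sub_eq_zero] at this
        rw [this, LinearMap.smul_apply, LinearMap.id_apply, inner_smul_right, hself]
        push_cast; ring
      obtain ⟨t, L, ht, hL, hL'⟩ := side A hA hno
      obtain ⟨s, M, hs, hM, hM'⟩ := side (-A) hA.neg hno.neg
      have hM'' : ∀ x ∈ M, inner ℂ x (A x) = ((-s * ‖x‖ ^ 2 : ℝ) : ℂ) := fun x hx => by
        have := hM' x hx
        rw [LinearMap.neg_apply, inner_neg_right, neg_eq_iff_eq_neg] at this
        rw [this]; push_cast; ring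
      have hpos : 0 < finrank ℂ E := lt_of_lt_of_le (by omega) (Submodule.finrank_le L)
      have hlt := hA.two_mul_lt_finrank hno hpos
      have hsup : finrank ℂ (L ⊔ M : Submodule ℂ E) < n := by
        have := Submodule.finrank_sup_add_finrank_inf_eq L M
        omega
      -- `L ⊔ M` is a proper subspace that keeps the index: `L` serves `Re ζ ≥ 0` and `M` serves `Re
      -- ζ ≤ 0`, so induction on dimension applies.
      have hLM : HasNonnegIndex (j + 1) (A.compress (L ⊔ M)) := by
        intro ζ hζ
        rcases le_total 0 ζ.re with hre | hre
        · obtain ⟨P, hP, hP'⟩ := exists_nonneg_compress (A := A) (W := L ⊔ M) (P := L)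
            le_sup_left (ζ := ζ) (c := 0) (fun x hx => by
              rw [numForm, hL' x hx, mul_comm ζ, Complex.re_ofReal_mul, zero_mul]; positivity)
          exact ⟨P, by omega, by simpa using hP'⟩
        · obtain ⟨P, hP, hP'⟩ := exists_nonneg_compress (A := A) (W := L ⊔ M) (P := M)
            le_sup_right (ζ := ζ) (c := 0) (fun x hx => by
              rw [numForm, hM'' x hx, mul_comm ζ, Complex.re_ofReal_mul, zero_mul]
              have : 0 ≤ s * ‖x‖ ^ 2 := by positivity
              nlinarith)
          exact ⟨P, by omega, by simpa using hP'⟩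
      obtain ⟨N, hN, hN'⟩ := IH _ hsup _ rfl _ _ hLM
      refine ⟨N.map (L ⊔ M).subtype, by rw [Submodule.finrank_map_subtype_eq, hN], ?_⟩
      rintro _ ⟨x, hx, rfl⟩
      have := hN' x hx
      rwa [LinearMap.inner_compress] at this
    · exact case1 A hA hno

end IsotropicExistence

/-! ### Eigenvalues of the pencil and the half-plane description of the numerical ranges. -/

section PencilEigenvalues

set_option linter.unusedSectionVars false

open scoped ComplexConjugate InnerProductSpace
open Module

/-- Courant–Fischer characterization of the eigenvalues of a symmetric operator. -/
theorem LinearMap.IsSymmetric.le_eigenvalues_iff {E : Type*} [NormedAddCommGroup E]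
    [InnerProductSpace ℂ E] [FiniteDimensional ℂ E] {T : E →ₗ[ℂ] E} (hT : T.IsSymmetric) {m : ℕ}
    (hm : finrank ℂ E = m) (i : Fin m) (c : ℝ) :
    c ≤ hT.eigenvalues hm i ↔ ∃ P : Submodule ℂ E, (i : ℕ) + 1 ≤ finrank ℂ P ∧
      ∀ x ∈ P, c * ‖x‖ ^ 2 ≤ (inner ℂ x (T x)).re := by
  constructor
  · intro hc
    obtain ⟨P, hP, hP'⟩ := hT.exists_spectral_submodule hm (Finset.Iic i)
    refine ⟨P, by rw [hP, Fin.card_Iic], fun x hx => ?_⟩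
    rw [(hP' x hx).2.1, (hP' x hx).2.2, Finset.mul_sum]
    refine Finset.sum_le_sum fun j hj => ?_
    gcongr
    exact hc.trans (hT.eigenvalues_antitone hm (Finset.mem_Iic.mp hj))
  · rintro ⟨P, hP, hP'⟩
    obtain ⟨V, hV, hV'⟩ := hT.exists_spectral_submodule hm (Finset.Ici i)
    rw [Fin.card_Ici] at hV
    obtain ⟨x, hxP, hxV, hx0⟩ := Submodule.exists_ne_zero_mem_inf (P := P) (V := V)
      (by have := i.2; omega)
    have h1 := hP' x hxP
    have h2 : (inner ℂ x (T x)).re ≤ hT.eigenvalues hm i * ‖x‖ ^ 2 := by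
      rw [(hV' x hxV).2.1, (hV' x hxV).2.2, Finset.mul_sum]
      refine Finset.sum_le_sum fun j hj => ?_
      gcongr
      exact hT.eigenvalues_antitone hm (Finset.mem_Ici.mp hj)
    have h3 : 0 < ‖x‖ ^ 2 := by positivity
    exact le_of_mul_le_mul_right (h1.trans h2) h3

/-- Complex polarization: the compression to `L` has zero quadratic form, hence is zero. -/
theorem inner_eq_zero_of_inner_self_eq_zero {E : Type*} [NormedAddCommGroup E]
    [InnerProductSpace ℂ E] [FiniteDimensional ℂ E] {B : E →ₗ[ℂ] E} {L : Submodule ℂ E}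
    (h : ∀ x ∈ L, inner ℂ x (B x) = 0) {x y : E} (hx : x ∈ L) (hy : y ∈ L) :
    inner ℂ x (B y) = 0 := by
  have hz : B.compress L = 0 := by
    rw [← inner_map_self_eq_zero]
    intro z
    rw [← inner_conj_symm, LinearMap.inner_compress, h z z.2, map_zero]
  have h1 := LinearMap.inner_compress B L ⟨x, hx⟩ ⟨y, hy⟩
  rwa [hz, LinearMap.zero_apply, inner_zero_right, eq_comm] at h1

variable {n : ℕ}

/-- The Hermitian matrix `x Re A + y Im A`. -/
noncomputable def hermPencil (A : Matrix (Fin n) (Fin n) ℂ) (u : ℝ × ℝ) :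
    Matrix (Fin n) (Fin n) ℂ :=
  (u.1 : ℂ) • ((ℜ A : selfAdjoint (Matrix (Fin n) (Fin n) ℂ)) : Matrix (Fin n) (Fin n) ℂ) +
    (u.2 : ℂ) • ((ℑ A : selfAdjoint (Matrix (Fin n) (Fin n) ℂ)) : Matrix (Fin n) (Fin n) ℂ)

theorem hermPencil_eq (A : Matrix (Fin n) (Fin n) ℂ) (u : ℝ × ℝ) :
    hermPencil A u = (2⁻¹ : ℂ) • (((u.1 : ℂ) - u.2 * Complex.I) • A +
      ((u.1 : ℂ) + u.2 * Complex.I) • Aᴴ) := by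
  ext i j
  simp only [hermPencil, realPart_apply_coe, imaginaryPart_apply_coe, Matrix.add_apply,
    Matrix.smul_apply, Matrix.star_eq_conjTranspose, Matrix.sub_apply, smul_eq_mul,
    Complex.real_smul]
  push_cast
  ring

theorem hermPencil_isHermitian (A : Matrix (Fin n) (Fin n) ℂ) (u : ℝ × ℝ) :
    (hermPencil A u).IsHermitian := by
  rw [Matrix.IsHermitian, hermPencil_eq]
  simp only [Matrix.conjTranspose_smul, Matrix.conjTranspose_add, Matrix.conjTranspose_conjTranspose]
  simp only [star_add, star_sub, star_mul', star_inv₀, star_ofNat, RCLike.star_def,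
    Complex.conj_ofReal, Complex.conj_I, mul_neg, sub_neg_eq_add, ← sub_eq_add_neg]
  rw [add_comm]

/-- The `(i+1)`-st largest eigenvalue of `x Re A + y Im A`. -/
noncomputable def pencilEig (A : Matrix (Fin n) (Fin n) ℂ) (u : ℝ × ℝ) (i : Fin n) : ℝ :=
  (hermPencil_isHermitian A u).eigenvalues₀ (Fin.cast (Fintype.card_fin n).symm i)

theorem pencilEig_antitone (A : Matrix (Fin n) (Fin n) ℂ) (u : ℝ × ℝ) :
    Antitone (pencilEig A u) := fun _ _ hij =>
  (hermPencil_isHermitian A u).eigenvalues₀_antitone hij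

open Polynomial in
theorem charpoly_hermPencil (A : Matrix (Fin n) (Fin n) ℂ) (u : ℝ × ℝ) :
    (hermPencil A u).charpoly = ∏ i, (X - C (pencilEig A u i : ℂ)) := by
  rw [(hermPencil_isHermitian A u).charpoly_eq]
  have e := Equiv.prod_comp
    ((Fintype.equivOfCardEq (Fintype.card_fin _) : Fin (Fintype.card (Fin n)) ≃ Fin n).symm.trans
      (finCongr (Fintype.card_fin n))) (fun i => (X - C (pencilEig A u i : ℂ)))
  rw [← e]
  rfl

theorem toEuclideanLin_hermPencil (A : Matrix (Fin n) (Fin n) ℂ) (u : ℝ × ℝ) :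
    Matrix.toEuclideanLin (hermPencil A u) =
      (2⁻¹ : ℂ) • hermPart (Matrix.toEuclideanLin A) ((u.1 : ℂ) - u.2 * Complex.I) := by
  rw [hermPencil_eq, map_smul, map_add, map_smul, map_smul,
    Matrix.toEuclideanLin_conjTranspose_eq_adjoint, hermPart]
  simp

/-- Courant–Fischer for the pencil. The conjugate `x - iy` appears because `Re ((x - iy)(a + bi)) =
xa + yb`. -/
theorem le_pencilEig_iff (A : Matrix (Fin n) (Fin n) ℂ) (u : ℝ × ℝ) (i : Fin n) (c : ℝ) :
    c ≤ pencilEig A u i ↔ ∃ P : Submodule ℂ (EuclideanSpace ℂ (Fin n)), (i : ℕ) + 1 ≤ finrank ℂ P ∧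
      ∀ x ∈ P, c * ‖x‖ ^ 2 ≤
        numForm (Matrix.toEuclideanLin A) ((u.1 : ℂ) - u.2 * Complex.I) x := by
  have h : ∀ x : EuclideanSpace ℂ (Fin n),
      (inner ℂ x (Matrix.toEuclideanLin (hermPencil A u) x)).re =
        numForm (Matrix.toEuclideanLin A) ((u.1 : ℂ) - u.2 * Complex.I) x := fun x => by
    rw [toEuclideanLin_hermPencil, LinearMap.smul_apply, inner_smul_right, inner_hermPart_self]
    norm_cast
    simp
  have := (Matrix.isSymmetric_toEuclideanLin_iff.mpr
    (hermPencil_isHermitian A u)).le_eigenvalues_iff finrank_euclideanSpace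
    (Fin.cast (Fintype.card_fin n).symm i) c
  simp only [h] at this
  exact this

/-- Weyl's inequality: a subspace that is optimal at `u` is nearly optimal at `v`. -/
theorem abs_pencilEig_sub_le (A : Matrix (Fin n) (Fin n) ℂ) :
    ∃ C : ℝ, 0 < C ∧ ∀ u v i, |pencilEig A u i - pencilEig A v i| ≤ C * ‖u - v‖ := by
  obtain ⟨C, hC, hb⟩ := exists_numForm_bound (Matrix.toEuclideanLin A)
  have key : ∀ u v i, pencilEig A u i - 2 * C * ‖u - v‖ ≤ pencilEig A v i := by
    intro u v i
    obtain ⟨P, hP, hP'⟩ := (le_pencilEig_iff A u i _).mp le_rfl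
    refine (le_pencilEig_iff A v i _).mpr ⟨P, hP, fun x hx => ?_⟩
    have h1 := hP' x hx
    have e : ((u.1 : ℂ) - u.2 * Complex.I) = ((v.1 : ℂ) - v.2 * Complex.I) +
        (((u.1 - v.1 : ℝ) : ℂ) - (u.2 - v.2 : ℝ) * Complex.I) := by push_cast; ring
    rw [e, numForm_add_left] at h1
    have h2 := hb (((u.1 - v.1 : ℝ) : ℂ) - (u.2 - v.2 : ℝ) * Complex.I) x
    have h3 : ‖(((u.1 - v.1 : ℝ) : ℂ) - (u.2 - v.2 : ℝ) * Complex.I)‖ ≤ 2 * ‖u - v‖ := by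
      refine (norm_sub_le _ _).trans ?_
      rw [norm_mul, Complex.norm_I, Complex.norm_real, Complex.norm_real, mul_one]
      have h4 : ‖u.1 - v.1‖ ≤ ‖u - v‖ := norm_fst_le (u - v)
      have h5 : ‖u.2 - v.2‖ ≤ ‖u - v‖ := norm_snd_le (u - v)
      linarith
    have h6 := (le_abs_self _).trans h2
    have h7 : ‖(((u.1 - v.1 : ℝ) : ℂ) - (u.2 - v.2 : ℝ) * Complex.I)‖ * C * ‖x‖ ^ 2 ≤
        2 * ‖u - v‖ * C * ‖x‖ ^ 2 := by gcongr
    linarith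
  refine ⟨2 * C, by positivity, fun u v i => abs_le.mpr ⟨?_, ?_⟩⟩
  · have := key v u i
    rw [norm_sub_rev] at this
    linarith
  · linarith [key u v i]

theorem continuous_pencilEig (A : Matrix (Fin n) (Fin n) ℂ) (i : Fin n) :
    Continuous fun u => pencilEig A u i := by
  obtain ⟨C, hC, h⟩ := abs_pencilEig_sub_le A
  refine (LipschitzWith.of_dist_le_mul (K := C.toNNReal) fun u v => ?_).continuous
  rw [Real.dist_eq, dist_eq_norm, Real.coe_toNNReal _ hC.le]
  exact h u v i

open Polynomial in
theorem pencilEig_zero (A : Matrix (Fin n) (Fin n) ℂ) (i : Fin n) : pencilEig A 0 i = 0 := by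
  have h := charpoly_hermPencil A 0
  have h0 : hermPencil A 0 = 0 := by simp [hermPencil]
  rw [h0, Matrix.charpoly_zero] at h
  have h1 := congrArg (eval (pencilEig A 0 i : ℂ)) h
  rw [eval_prod, Finset.prod_eq_zero (Finset.mem_univ i) (by simp)] at h1
  simp only [eval_pow, eval_X] at h1
  exact_mod_cast eq_zero_of_pow_eq_zero h1

theorem abs_pencilEig_le (A : Matrix (Fin n) (Fin n) ℂ) :
    ∃ C : ℝ, 0 < C ∧ ∀ u v i, |pencilEig A u i - pencilEig A v i| ≤ C * ‖u - v‖ ∧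
      |pencilEig A u i| ≤ C * ‖u‖ := by
  obtain ⟨C, hC, h⟩ := abs_pencilEig_sub_le A
  refine ⟨C, hC, fun u v i => ⟨h u v i, ?_⟩⟩
  simpa [pencilEig_zero] using h u 0 i

open Polynomial in
/-- Two antitone families with the same characteristic polynomial coincide. -/
theorem Antitone.eq_of_prod_X_sub_C_eq {d : ℕ} {f g : Fin d → ℝ} (hf : Antitone f)
    (hg : Antitone g) (h : ∏ i, (X - C (f i : ℂ)) = ∏ i, (X - C (g i : ℂ))) : f = g := by
  have h1 := congrArg roots h
  rw [roots_prod _ _ (Finset.prod_ne_zero_iff.mpr fun i _ => X_sub_C_ne_zero _),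
    roots_prod _ _ (Finset.prod_ne_zero_iff.mpr fun i _ => X_sub_C_ne_zero _)] at h1
  simp only [roots_X_sub_C, Multiset.bind_singleton] at h1
  have h2 := congrArg (Multiset.map Complex.re) h1
  simp only [Multiset.map_map, Function.comp_def, Complex.ofReal_re] at h2
  rw [Fin.univ_val_map, Fin.univ_val_map, Multiset.coe_eq_coe] at h2
  exact List.ofFn_injective (h2.eq_of_pairwise' (r := (· ≥ ·))
    (List.sortedGE_iff_pairwise.mp hf.sortedGE_ofFn)
    (List.sortedGE_iff_pairwise.mp hg.sortedGE_ofFn))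

open Polynomial in
theorem pencilEig_neg (A : Matrix (Fin n) (Fin n) ℂ) (u : ℝ × ℝ) (i : Fin n) :
    pencilEig A (-u) i = -pencilEig A u i.rev := by
  have hanti : Antitone fun i : Fin n => -pencilEig A u i.rev := fun i j hij =>
    neg_le_neg (pencilEig_antitone A u (Fin.rev_le_rev.mpr hij))
  refine congrFun (Antitone.eq_of_prod_X_sub_C_eq (pencilEig_antitone A (-u)) hanti ?_) i
  rw [← charpoly_hermPencil]
  refine Polynomial.funext fun z => ?_
  have h0 : hermPencil A (-u) = -hermPencil A u := by
    simp [hermPencil, add_comm]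
  have h1 : (hermPencil A u).charpoly.eval (-z) = ∏ i, (-z - pencilEig A u i) := by
    rw [charpoly_hermPencil, eval_prod]; simp
  rw [Matrix.eval_charpoly] at h1 ⊢
  have h2 : Matrix.scalar (Fin n) z - hermPencil A (-u) =
      -(Matrix.scalar (Fin n) (-z) - hermPencil A u) := by
    rw [h0, map_neg]; abel
  rw [h2, Matrix.det_neg, h1, eval_prod, Fintype.card_fin]
  have h3 : ∏ i : Fin n, eval z (X - C ((-pencilEig A u i.rev : ℝ) : ℂ)) =
      ∏ i, eval z (X - C ((-pencilEig A u i : ℝ) : ℂ)) :=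
    Equiv.prod_comp Fin.revPerm fun i : Fin n => eval z (X - C ((-pencilEig A u i : ℝ) : ℂ))
  rw [h3]
  have h4 : ((-1 : ℂ)) ^ n = ∏ i : Fin n, (-1 : ℂ) := by simp
  rw [h4, ← Finset.prod_mul_distrib]
  refine Finset.prod_congr rfl fun i _ => ?_
  simp
  ring

/-- `L` is the column space of `X`; conversely the columns of `X` form an orthonormal basis of `L`,
and polarization recovers the off-diagonal entries. -/
theorem mem_rankNumericalRange_iff (A : Matrix (Fin n) (Fin n) ℂ) (k : ℕ) (w : ℂ) :
    w ∈ rankNumericalRange k A ↔ ∃ L : Submodule ℂ (EuclideanSpace ℂ (Fin n)), finrank ℂ L = k ∧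
      ∀ x ∈ L, inner ℂ x ((Matrix.toEuclideanLin A - w • LinearMap.id :
        EuclideanSpace ℂ (Fin n) →ₗ[ℂ] EuclideanSpace ℂ (Fin n)) x) = 0 := by
  constructor
  · rintro ⟨X, hX, hXA⟩
    have hadj : ∀ (v : EuclideanSpace ℂ (Fin k)) (y : EuclideanSpace ℂ (Fin n)),
        inner ℂ (Matrix.toEuclideanLin X v) y = inner ℂ v (Matrix.toEuclideanLin Xᴴ y) := by
      intro v y
      rw [Matrix.toEuclideanLin_conjTranspose_eq_adjoint, LinearMap.adjoint_inner_right]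
    have hmul : ∀ {a b c : ℕ} (M : Matrix (Fin a) (Fin b) ℂ) (N : Matrix (Fin b) (Fin c) ℂ)
        (v : EuclideanSpace ℂ (Fin c)), Matrix.toEuclideanLin M (Matrix.toEuclideanLin N v) =
          Matrix.toEuclideanLin (M * N) v := by
      intro a b c M N v
      simp
    have hone : ∀ v : EuclideanSpace ℂ (Fin k),
        Matrix.toEuclideanLin (1 : Matrix (Fin k) (Fin k) ℂ) v = v := by
      intro v
      simp
    refine ⟨LinearMap.range (Matrix.toEuclideanLin X), ?_, ?_⟩
    · rw [LinearMap.finrank_range_of_inj, finrank_euclideanSpace_fin]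
      intro v v' h
      have := congrArg (Matrix.toEuclideanLin Xᴴ) h
      rwa [hmul, hmul, hX, hone, hone] at this
    · rintro _ ⟨v, rfl⟩
      rw [LinearMap.sub_apply, inner_sub_right, hadj, hmul, hmul, hXA,
        map_smul, LinearMap.smul_apply, hone, LinearMap.smul_apply, LinearMap.id_apply,
        inner_smul_right, inner_smul_right, hadj, hmul, hX, hone, sub_self]
  · rintro ⟨L, hL, hL0⟩
    set T := Matrix.toEuclideanLin A with hT
    have hxy : ∀ x y : L, inner ℂ (x : EuclideanSpace ℂ (Fin n)) (T y) = w * inner ℂ x y := by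
      intro x y
      have h1 := inner_eq_zero_of_inner_self_eq_zero hL0 x.2 y.2
      rw [LinearMap.sub_apply, inner_sub_right, LinearMap.smul_apply, LinearMap.id_apply,
        inner_smul_right, sub_eq_zero] at h1
      rw [h1, Submodule.coe_inner]
    let b : OrthonormalBasis (Fin k) ℂ L :=
      (stdOrthonormalBasis ℂ L).reindex (finCongr hL)
    have hinner : ∀ x y : EuclideanSpace ℂ (Fin n), inner ℂ x y = ∑ i, conj (x i) * y i := by
      intro x y
      rw [PiLp.inner_apply]
      simp [mul_comm]
    have horth : ∀ i j, inner ℂ (b i) (b j) = (1 : Matrix (Fin k) (Fin k) ℂ) i j := by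
      intro i j
      rw [orthonormal_iff_ite.mp b.orthonormal i j, Matrix.one_apply]
    refine ⟨Matrix.of fun i j => (b j : EuclideanSpace ℂ (Fin n)) i, ?_, ?_⟩
    · ext i j
      rw [← horth, Submodule.coe_inner, hinner]
      simp [Matrix.mul_apply]
    · ext i j
      rw [Matrix.smul_apply, ← horth, smul_eq_mul, ← hxy, hinner, Matrix.mul_assoc]
      simp only [Matrix.mul_apply, Matrix.conjTranspose_apply, Matrix.of_apply, hT,
        Matrix.toLpLin_apply, Matrix.mulVec, dotProduct]
      rfl

/-- The description of the rank-`k` numerical range as an intersection of half planes. -/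
theorem mem_rankNumericalRange_iff_le_pencilEig (A : Matrix (Fin n) (Fin n) ℂ) (i : Fin n)
    (w : ℂ) : w ∈ rankNumericalRange (i + 1) A ↔
      ∀ u : ℝ × ℝ, u.1 * w.re + u.2 * w.im ≤ pencilEig A u i := by
  have hform : ∀ (ζ : ℂ) (x : EuclideanSpace ℂ (Fin n)),
      numForm (Matrix.toEuclideanLin A - w • LinearMap.id) ζ x =
        numForm (Matrix.toEuclideanLin A) ζ x - (ζ.re * w.re - ζ.im * w.im) * ‖x‖ ^ 2 := by
    intro ζ x
    have h : inner ℂ x x = ((‖x‖ ^ 2 : ℝ) : ℂ) := by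
      rw [inner_self_eq_norm_sq_to_K]; norm_cast
    simp only [numForm, LinearMap.sub_apply, LinearMap.smul_apply, LinearMap.id_apply,
      inner_sub_right, inner_smul_right, mul_sub, Complex.sub_re, h]
    rw [← mul_assoc, Complex.re_mul_ofReal, Complex.mul_re ζ w]
  rw [mem_rankNumericalRange_iff]
  constructor
  · rintro ⟨L, hL, hL0⟩ u
    refine (le_pencilEig_iff A u i _).mpr ⟨L, hL.ge, fun x hx => ?_⟩
    have h1 := hform ((u.1 : ℂ) - u.2 * Complex.I) x
    rw [numForm, hL0 x hx] at h1
    simp at h1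
    linarith
  · intro h
    -- The half-plane inequality in direction `(Re ζ, -Im ζ)` is exactly the index condition at `ζ`
    -- for `A - w`.
    refine HasNonnegIndex.exists_isotropic n _ finrank_euclideanSpace_fin _ _ fun ζ _ => ?_
    obtain ⟨P, hP, hP'⟩ := (le_pencilEig_iff A (ζ.re, -ζ.im) i _).mp (h (ζ.re, -ζ.im))
    refine ⟨P, hP, fun x hx => ?_⟩
    have h1 := hP' x hx
    have e : ((ζ.re : ℂ) - ((-ζ.im : ℝ) : ℂ) * Complex.I) = ζ := by
      push_cast
      rw [neg_mul, sub_neg_eq_add, Complex.re_add_im]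
    rw [e] at h1
    rw [hform]
    linarith

end PencilEigenvalues

/-! ### Roots of a monic factor: continuity, Lipschitz bounds, homogeneity. -/

section RealRootedFactors

open Polynomial Filter Topology

variable {n : ℕ}

/-- Coordinate functions on the real plane as a point of `Fin 2 → ℂ`. -/
def planePoint (u : ℝ × ℝ) : Fin 2 → ℂ := ![(u.1 : ℂ), (u.2 : ℂ)]

/-- The matrix `X₀ Re A + X₁ Im A` over `ℂ[X₀, X₁]`. -/
noncomputable def genericPencil (A : Matrix (Fin n) (Fin n) ℂ) :
    Matrix (Fin n) (Fin n) (MvPolynomial (Fin 2) ℂ) :=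
  (MvPolynomial.X 0 : MvPolynomial (Fin 2) ℂ) •
      ((ℜ A : selfAdjoint (Matrix (Fin n) (Fin n) ℂ)) : Matrix (Fin n) (Fin n) ℂ).map
        MvPolynomial.C +
    (MvPolynomial.X 1 : MvPolynomial (Fin 2) ℂ) •
      ((ℑ A : selfAdjoint (Matrix (Fin n) (Fin n) ℂ)) : Matrix (Fin n) (Fin n) ℂ).map
        MvPolynomial.C

/-- Specialization of a polynomial over `ℂ[X₀, X₁]` at a real point of the plane. -/
noncomputable def specialize (q : (MvPolynomial (Fin 2) ℂ)[X]) (u : ℝ × ℝ) : ℂ[X] :=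
  q.map (MvPolynomial.eval (planePoint u))

theorem specialize_charpoly (A : Matrix (Fin n) (Fin n) ℂ) (u : ℝ × ℝ) :
    specialize (genericPencil A).charpoly u = ∏ i, (X - C (pencilEig A u i : ℂ)) := by
  rw [specialize, ← Matrix.charpoly_map, ← charpoly_hermPencil]
  congr 1
  ext i j
  simp [genericPencil, hermPencil, planePoint]

theorem continuous_planePoint : Continuous planePoint := by
  unfold planePoint
  refine continuous_pi fun i => ?_
  fin_cases i <;> simp <;> fun_prop

theorem continuous_eval_specialize (q : (MvPolynomial (Fin 2) ℂ)[X]) (z : ℂ) :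
    Continuous fun u => (specialize q u).eval z := by
  simp only [specialize, eval_map, eval₂_eq_sum_range]
  exact continuous_finsetSum _ fun i _ =>
    ((MvPolynomial.continuous_eval _).comp continuous_planePoint).mul continuous_const

/-- A monic divisor of a real-rooted polynomial, with its roots in decreasing order. -/
theorem exists_antitone_roots {d : ℕ} {e : Fin n → ℝ} {p : ℂ[X]} (hp : p.Monic)
    (hd : p.natDegree = d) (hdvd : p ∣ ∏ i, (X - C (e i : ℂ))) :
    ∃ r : Fin d → ℝ, Antitone r ∧ p = ∏ i, (X - C (r i : ℂ)) ∧ ∀ i, ∃ j, r i = e j := by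
  have hne : ∏ i, (X - C (e i : ℂ)) ≠ 0 :=
    Finset.prod_ne_zero_iff.mpr fun i _ => X_sub_C_ne_zero _
  have hs : p.Splits := Splits.of_dvd (Splits.prod fun i _ => Splits.X_sub_C _) hne hdvd
  have hroot : ∀ x ∈ p.roots, ∃ j, x = (e j : ℂ) := by
    intro x hx
    have h1 := (mem_roots hne).mp (Multiset.mem_of_le (roots.le_of_dvd hne hdvd) hx)
    rw [IsRoot, eval_prod, Finset.prod_eq_zero_iff] at h1
    obtain ⟨j, -, hj⟩ := h1
    exact ⟨j, by simpa [sub_eq_zero] using hj⟩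
  set l := (p.roots.map Complex.re).sort (· ≥ ·) with hl
  have hlen : l.length = d := by
    rw [hl, Multiset.length_sort, Multiset.card_map, ← hs.natDegree_eq_card_roots, hd]
  subst hlen
  have hl' : ((l : List ℝ) : Multiset ℝ) = p.roots.map Complex.re := Multiset.sort_eq _ _
  have hmap : p.roots = (l : Multiset ℝ).map (fun x : ℝ => (x : ℂ)) := by
    rw [hl', Multiset.map_map]
    conv_lhs => rw [← Multiset.map_id p.roots]
    refine Multiset.map_congr rfl fun x hx => ?_
    obtain ⟨j, rfl⟩ := hroot x hx
    simp
  refine ⟨l.get, (List.sortedGE_iff_pairwise.mpr (Multiset.pairwise_sort _ _)).antitone_get, ?_, ?_⟩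
  · rw [hs.eq_prod_roots, hp.leadingCoeff, C_1, one_mul, hmap, Multiset.map_map, Multiset.map_coe,
      Multiset.prod_coe]
    conv_lhs => rw [← List.ofFn_get l, List.map_ofFn, List.prod_ofFn]
    rfl
  · intro i
    have h1 : l.get i ∈ (l : Multiset ℝ) := List.get_mem l i
    rw [hl', Multiset.mem_map] at h1
    obtain ⟨x, hx, hx'⟩ := h1
    obtain ⟨j, rfl⟩ := hroot x hx
    exact ⟨j, by rw [← hx', Complex.ofReal_re]⟩

/-- `r u` lists in decreasing order the roots of the specialization of `q` at `u`, all of which are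
eigenvalues of the pencil of `A`. -/
structure IsRootFamily (A : Matrix (Fin n) (Fin n) ℂ) (q : (MvPolynomial (Fin 2) ℂ)[X]) {d : ℕ}
    (r : ℝ × ℝ → Fin d → ℝ) : Prop where
  antitone : ∀ u, Antitone (r u)
  eq_prod : ∀ u, specialize q u = ∏ i, (X - C (r u i : ℂ))
  mem : ∀ u i, ∃ j, r u i = pencilEig A u j

theorem exists_isRootFamily (A : Matrix (Fin n) (Fin n) ℂ) {q : (MvPolynomial (Fin 2) ℂ)[X]}
    (hq : q.Monic) (hdvd : q ∣ (genericPencil A).charpoly) :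
    ∃ r : ℝ × ℝ → Fin q.natDegree → ℝ, IsRootFamily A q r := by
  have h : ∀ u, ∃ r : Fin q.natDegree → ℝ, Antitone r ∧
      specialize q u = ∏ i, (X - C (r i : ℂ)) ∧ ∀ i, ∃ j, r i = pencilEig A u j := fun u =>
    exists_antitone_roots (hq.map _) (hq.natDegree_map _)
      (by rw [← specialize_charpoly]; exact Polynomial.map_dvd _ hdvd)
  choose r h1 h2 h3 using h
  exact ⟨r, h1, h2, h3⟩

variable {A : Matrix (Fin n) (Fin n) ℂ} {q : (MvPolynomial (Fin 2) ℂ)[X]} {d : ℕ}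
  {r : ℝ × ℝ → Fin d → ℝ}

theorem IsRootFamily.eval_eq (hr : IsRootFamily A q r) (u : ℝ × ℝ) (z : ℂ) :
    (specialize q u).eval z = ∏ i, (z - r u i) := by
  rw [hr.eq_prod, eval_prod]; simp

theorem IsRootFamily.exists_bound (hr : IsRootFamily A q r) :
    ∃ C : ℝ, 0 < C ∧ ∀ u i, |r u i| ≤ C * ‖u‖ := by
  obtain ⟨C, hC, h⟩ := abs_pencilEig_le A
  refine ⟨C, hC, fun u i => ?_⟩
  obtain ⟨j, hj⟩ := hr.mem u i
  rw [hj]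
  exact (h u u j).2

/-- Roots are locally bounded, so they converge along any ultrafilter; the limit is ordered and has
the same polynomial as `r u₀`, hence equals it. -/
theorem IsRootFamily.continuous (hr : IsRootFamily A q r) : Continuous r := by
  rw [continuous_iff_continuousAt]
  intro u₀
  rw [ContinuousAt, tendsto_iff_ultrafilter]
  intro g hg
  obtain ⟨C, hC, hb⟩ := hr.exists_bound
  set M := C * (‖u₀‖ + 1) with hM
  have hK : IsCompact (Set.univ.pi fun _ : Fin d => Set.Icc (-M) M) :=
    isCompact_univ_pi fun _ => isCompact_Icc
  have hev : ∀ᶠ u in 𝓝 u₀, r u ∈ Set.univ.pi fun _ : Fin d => Set.Icc (-M) M := by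
    have : ∀ᶠ u in 𝓝 u₀, ‖u‖ < ‖u₀‖ + 1 :=
      continuous_norm.continuousAt.eventually_lt continuousAt_const (lt_add_one _)
    filter_upwards [this] with u hu
    intro i _
    refine abs_le.mp ((hb u i).trans ?_)
    rw [hM]; gcongr
  obtain ⟨s, -, hs⟩ := hK.ultrafilter_le_nhds (g.map r)
    (le_principal_iff.mpr (hg hev))
  have hs' : Tendsto r g (𝓝 s) := hs
  have hsi : ∀ i, Tendsto (fun u => r u i) g (𝓝 (s i)) := tendsto_pi_nhds.mp hs'
  have hanti : Antitone s := fun i j hij =>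
    le_of_tendsto_of_tendsto' (hsi j) (hsi i) fun u => hr.antitone u hij
  have heq : s = r u₀ := by
    refine hanti.eq_of_prod_X_sub_C_eq (hr.antitone u₀) (Polynomial.funext fun z => ?_)
    have h1 : Tendsto (fun u => (specialize q u).eval z) g (𝓝 ((specialize q u₀).eval z)) :=
      ((continuous_eval_specialize q z).tendsto u₀).mono_left hg
    have h2 : Tendsto (fun u => ∏ i, (z - (r u i : ℂ))) g (𝓝 (∏ i, (z - (s i : ℂ)))) :=
      tendsto_finsetProd _ fun i _ =>
        tendsto_const_nhds.sub ((Complex.continuous_ofReal.tendsto _).comp (hsi i))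
    simp only [hr.eval_eq] at h1
    have := tendsto_nhds_unique h2 h1
    simpa [eval_prod] using this
  rw [← heq]
  exact hs'

theorem IsRootFamily.continuous_apply (hr : IsRootFamily A q r) (i : Fin d) :
    Continuous fun u => r u i := (_root_.continuous_apply i).comp hr.continuous

/-- The roots are Lipschitz at each point. -/
theorem IsRootFamily.eventually_abs_sub_le (hr : IsRootFamily A q r) (u₀ : ℝ × ℝ) (i : Fin d) :
    ∃ C : ℝ, 0 < C ∧ ∀ᶠ u in 𝓝 u₀, |r u i - r u₀ i| ≤ C * ‖u - u₀‖ := by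
  obtain ⟨C, hC, h⟩ := abs_pencilEig_le A
  refine ⟨C, hC, ?_⟩
  -- Near `u₀` the root can coincide only with eigenvalue functions that already agree with it at
  -- `u₀`, and those are Lipschitz.
  have hev : ∀ᶠ u in 𝓝 u₀, ∀ j, pencilEig A u₀ j ≠ r u₀ i → pencilEig A u j ≠ r u i := by
    rw [eventually_all]
    intro j
    by_cases hj : pencilEig A u₀ j = r u₀ i
    · simp [hj]
    · have hc : ContinuousAt (fun u => pencilEig A u j - r u i) u₀ :=
        ((continuous_pencilEig A j).sub (hr.continuous_apply i)).continuousAt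
      filter_upwards [hc.eventually_ne (sub_ne_zero.mpr hj)] with u hu _
      exact sub_ne_zero.mp hu
  filter_upwards [hev] with u hu
  obtain ⟨j, hj⟩ := hr.mem u i
  have h0 : pencilEig A u₀ j = r u₀ i := by
    by_contra hcon
    exact hu j hcon hj.symm
  rw [hj, ← h0]
  exact (h u u₀ j).1

/-- A complex polynomial with growth `O((1 + |t|) ^ d)` on the real line has degree at most `d`. -/
theorem Polynomial.natDegree_le_of_norm_eval_le {f : ℂ[X]} {d : ℕ} {C : ℝ}
    (h : ∀ t : ℝ, ‖f.eval (t : ℂ)‖ ≤ C * (1 + |t|) ^ d) : f.natDegree ≤ d := by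
  by_contra hcon
  push Not at hcon
  have hf : f ≠ 0 := by
    rintro rfl
    simp at hcon
  have htend : Tendsto (fun t : ℝ => (t : ℂ)) atTop (Bornology.cobounded ℂ) := by
    rw [← tendsto_norm_atTop_iff_cobounded]
    simpa using tendsto_abs_atTop_atTop
  have h1 := (isEquivalent_cobounded_leading_monomial (P := f)).symm.isBigO.comp_tendsto htend
  have h2 : (fun t : ℝ => f.eval (t : ℂ)) =O[atTop] fun t : ℝ => t ^ d := by
    refine Asymptotics.IsBigO.of_bound (|C| * 2 ^ d) ?_
    filter_upwards [eventually_ge_atTop (1 : ℝ)] with t ht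
    have ht0 : 0 ≤ t := by linarith
    refine (h t).trans ?_
    rw [abs_of_nonneg ht0, Real.norm_of_nonneg (by positivity), mul_assoc, ← mul_pow]
    gcongr
    · exact le_abs_self C
    · linarith
  have h3 : (fun t : ℝ => f.leadingCoeff * (t : ℂ) ^ f.natDegree) =o[atTop]
      fun t : ℝ => t ^ f.natDegree :=
    (h1.trans h2).trans_isLittleO (Asymptotics.isLittleO_pow_pow_atTop_of_lt hcon)
  have h4 : (fun t : ℝ => t ^ f.natDegree) =O[atTop]
      fun t : ℝ => f.leadingCoeff * (t : ℂ) ^ f.natDegree := by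
    refine Asymptotics.IsBigO.of_bound (‖f.leadingCoeff‖⁻¹) (Eventually.of_forall fun t => ?_)
    have : ‖f.leadingCoeff‖ ≠ 0 := by simpa using hf
    rw [norm_mul, norm_pow, norm_pow, Complex.norm_real, inv_mul_cancel_left₀ this]
  refine Asymptotics.isLittleO_irrefl ?_ (h4.trans_isLittleO h3)
  refine Eventually.frequently ?_
  filter_upwards [eventually_gt_atTop (0 : ℝ)] with t ht
  positivity

/-- A complex polynomial that is `O(|t - t₀| ^ m)` on the real line vanishes to order `m`. -/
theorem Polynomial.le_rootMultiplicity_of_norm_eval_le {f : ℂ[X]} (hf : f ≠ 0) {m : ℕ} {C t₀ : ℝ}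
    (h : ∀ᶠ t in 𝓝 t₀, ‖f.eval ((t : ℝ) : ℂ)‖ ≤ C * |t - t₀| ^ m) :
    m ≤ f.rootMultiplicity (t₀ : ℂ) := by
  obtain ⟨g, hg, hndvd⟩ := exists_eq_pow_rootMultiplicity_mul_and_not_dvd f hf (t₀ : ℂ)
  set j := f.rootMultiplicity (t₀ : ℂ) with hj
  by_contra hcon
  push Not at hcon
  obtain ⟨k, rfl⟩ : ∃ k, m = j + (k + 1) := ⟨m - j - 1, by omega⟩
  have h1 : ∀ᶠ t in 𝓝[≠] t₀, ‖g.eval ((t : ℝ) : ℂ)‖ ≤ C * |t - t₀| ^ (k + 1) := by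
    filter_upwards [h.filter_mono nhdsWithin_le_nhds, self_mem_nhdsWithin] with t ht hne
    have hpos : 0 < |t - t₀| ^ j := pow_pos (abs_pos.mpr (sub_ne_zero.mpr hne)) _
    rw [hg, eval_mul, eval_pow, eval_sub, eval_X, eval_C, norm_mul, norm_pow,
      ← Complex.ofReal_sub, Complex.norm_real, Real.norm_eq_abs, pow_add] at ht
    refine le_of_mul_le_mul_left (ht.trans (le_of_eq ?_)) hpos
    ring
  have h2 : Tendsto (fun t : ℝ => C * |t - t₀| ^ (k + 1)) (𝓝[≠] t₀) (𝓝 0) := by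
    have : Continuous fun t : ℝ => C * |t - t₀| ^ (k + 1) := by fun_prop
    have h3 := this.tendsto t₀
    simp only [sub_self, abs_zero, ne_eq, Nat.add_eq_zero_iff, one_ne_zero, and_false,
      not_false_eq_true, zero_pow, mul_zero] at h3
    exact h3.mono_left nhdsWithin_le_nhds
  have h3 : Tendsto (fun t : ℝ => ‖g.eval ((t : ℝ) : ℂ)‖) (𝓝[≠] t₀) (𝓝 ‖g.eval (t₀ : ℂ)‖) := by
    have : Continuous fun t : ℝ => ‖g.eval ((t : ℝ) : ℂ)‖ :=
      (g.continuous.comp Complex.continuous_ofReal).norm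
    exact (this.tendsto t₀).mono_left nhdsWithin_le_nhds
  have h4 := le_of_tendsto_of_tendsto h3 h2 h1
  exact hndvd (dvd_iff_isRoot.mpr (norm_le_zero_iff.mp h4))

/-- The restriction of `q` to the line `t ↦ (u + t v, c + t c')`. -/
noncomputable def restrictLine (q : (MvPolynomial (Fin 2) ℂ)[X]) (u v : ℝ × ℝ) (c c' : ℂ) : ℂ[X] :=
  q.eval₂ (MvPolynomial.aeval fun i => C (planePoint u i) + C (planePoint v i) * X).toRingHom
    (C c + C c' * X)

theorem eval_restrictLine (q : (MvPolynomial (Fin 2) ℂ)[X]) (u v : ℝ × ℝ) (c c' : ℂ) (t : ℝ) :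
    (restrictLine q u v c c').eval (t : ℂ) = (specialize q (u + t • v)).eval (c + c' * t) := by
  rw [restrictLine, ← coe_evalRingHom, hom_eval₂, specialize, eval_map]
  congr 1
  · refine MvPolynomial.ringHom_ext (fun a => by simp) fun i => ?_
    fin_cases i <;> simp [planePoint] <;> ring
  · simp

/-- Homogeneity of `q` from the linear bound on its roots: along a line through the origin the
polynomial is at most a constant times `|t|^d`, which bounds its degree above and its order at `0`
below by `d`, leaving a monomial. -/
theorem IsRootFamily.eval_smul (hr : IsRootFamily A q r) (u : ℝ × ℝ) (z : ℂ) (τ : ℝ) :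
    (specialize q (τ • u)).eval (z * τ) = (τ : ℂ) ^ d * (specialize q u).eval z := by
  obtain ⟨C₀, hC₀, hb⟩ := hr.exists_bound
  set f := restrictLine q 0 u 0 z with hf
  have hev : ∀ t : ℝ, f.eval (t : ℂ) = (specialize q (t • u)).eval (z * t) := fun t => by
    rw [hf, eval_restrictLine, zero_add, zero_add]
  have hbound : ∀ t : ℝ, ‖f.eval (t : ℂ)‖ ≤ (‖z‖ + C₀ * ‖u‖) ^ d * |t| ^ d := by
    intro t
    rw [hev, hr.eval_eq, norm_prod, ← mul_pow]
    have hcard : ((‖z‖ + C₀ * ‖u‖) * |t|) ^ d = ∏ i : Fin d, ((‖z‖ + C₀ * ‖u‖) * |t|) := by simp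
    rw [hcard]
    refine Finset.prod_le_prod (fun i _ => norm_nonneg _) fun i _ => ?_
    refine (norm_sub_le _ _).trans ?_
    have h1 := hb (t • u) i
    rw [norm_smul, Real.norm_eq_abs] at h1
    rw [norm_mul, Complex.norm_real, Complex.norm_real, Real.norm_eq_abs, Real.norm_eq_abs]
    linarith
  have hdeg : f.natDegree ≤ d := natDegree_le_of_norm_eval_le fun t => (hbound t).trans (by
    gcongr; linarith)
  have hmono : ∃ a, f = C a * X ^ d := by
    by_cases hf0 : f = 0
    · exact ⟨0, by simp [hf0]⟩
    have h1 : d ≤ f.rootMultiplicity ((0 : ℝ) : ℂ) :=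
      le_rootMultiplicity_of_norm_eval_le hf0 (Eventually.of_forall fun t => by
        rw [sub_zero]; exact hbound t)
    rw [le_rootMultiplicity_iff hf0, Complex.ofReal_zero, C_0, sub_zero] at h1
    obtain ⟨g, hg⟩ := h1
    have hg0 : g ≠ 0 := fun h => hf0 (by rw [hg, h, mul_zero])
    have h2 : f.natDegree = d + g.natDegree := by
      rw [hg, natDegree_mul (pow_ne_zero _ X_ne_zero) hg0, natDegree_X_pow]
    exact ⟨g.coeff 0, by rw [← eq_C_of_natDegree_eq_zero (by omega : g.natDegree = 0), mul_comm, ← hg]⟩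
  obtain ⟨a, ha⟩ := hmono
  have h1 := hev 1
  rw [ha] at h1
  simp only [eval_mul, eval_C, eval_pow, eval_X, Complex.ofReal_one, one_pow, mul_one,
    one_smul] at h1
  rw [← hev, ha, ← h1, eval_mul, eval_C, eval_pow, eval_X, mul_comm]

theorem IsRootFamily.prod_smul (hr : IsRootFamily A q r) (u : ℝ × ℝ) {τ : ℝ} (hτ : τ ≠ 0) :
    ∏ i, (X - C (r (τ • u) i : ℂ)) = ∏ i, (X - C ((τ * r u i : ℝ) : ℂ)) := by
  refine Polynomial.funext fun y => ?_
  have hτ' : (τ : ℂ) ≠ 0 := by exact_mod_cast hτ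
  have h1 := hr.eval_smul u (y / τ) τ
  rw [div_mul_cancel₀ _ hτ', hr.eval_eq, hr.eval_eq] at h1
  rw [eval_prod, eval_prod]
  simp only [eval_sub, eval_X, eval_C]
  rw [h1]
  have h2 : (τ : ℂ) ^ d = ∏ i : Fin d, (τ : ℂ) := by simp
  rw [h2, ← Finset.prod_mul_distrib]
  refine Finset.prod_congr rfl fun i _ => ?_
  push_cast
  field_simp

theorem IsRootFamily.smul_of_pos (hr : IsRootFamily A q r) (u : ℝ × ℝ) {τ : ℝ} (hτ : 0 < τ)
    (i : Fin d) : r (τ • u) i = τ * r u i :=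
  congrFun ((hr.antitone _).eq_of_prod_X_sub_C_eq
    (fun _ _ hij => mul_le_mul_of_nonneg_left (hr.antitone u hij) hτ.le)
    (hr.prod_smul u hτ.ne')) i

theorem IsRootFamily.neg (hr : IsRootFamily A q r) (u : ℝ × ℝ) (i : Fin d) :
    r (-u) i = -r u i.rev := by
  have h := hr.prod_smul u (τ := -1) (by norm_num)
  rw [neg_one_smul] at h
  have h2 : ∏ i, (X - C ((-1 * r u i : ℝ) : ℂ)) =
      ∏ i : Fin d, (X - C ((-r u i.rev : ℝ) : ℂ)) := by
    simp only [neg_one_mul]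
    exact (Equiv.prod_comp Fin.revPerm fun i : Fin d => X - C ((-r u i : ℝ) : ℂ)).symm
  exact congrFun ((hr.antitone _).eq_of_prod_X_sub_C_eq
    (fun i j hij => neg_le_neg (hr.antitone u (Fin.rev_le_rev.mpr hij))) (h.trans h2)) i

end RealRootedFactors

/-! ### Sublinearity of the largest root. -/

section TopRoot

open Polynomial Filter Topology

variable {n : ℕ} {A : Matrix (Fin n) (Fin n) ℂ} {q : (MvPolynomial (Fin 2) ℂ)[X]} {d : ℕ}
  {r : ℝ × ℝ → Fin d → ℝ}

theorem IsRootFamily.eval_restrictLine_eq (hr : IsRootFamily A q r) (u v : ℝ × ℝ) (c c' t : ℝ) :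
    (restrictLine q u v c c').eval (t : ℂ) = ∏ i, ((c + c' * t - r (u + t • v) i : ℝ) : ℂ) := by
  rw [eval_restrictLine, hr.eval_eq]
  push_cast
  rfl

theorem IsRootFamily.natDegree_restrictLine_le (hr : IsRootFamily A q r) (u v : ℝ × ℝ) (c c' : ℝ) :
    (restrictLine q u v c c').natDegree ≤ d := by
  obtain ⟨C₀, hC₀, hb⟩ := hr.exists_bound
  set K := |c| + |c'| + C₀ * (‖u‖ + ‖v‖) with hK
  refine natDegree_le_of_norm_eval_le (C := K ^ d) fun t => ?_
  have hcard : K ^ d * (1 + |t|) ^ d = ∏ i : Fin d, (K * (1 + |t|)) := by simp [mul_pow]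
  rw [hr.eval_restrictLine_eq, norm_prod, hcard]
  refine Finset.prod_le_prod (fun i _ => norm_nonneg _) fun i _ => ?_
  rw [Complex.norm_real, Real.norm_eq_abs]
  have h1 := hb (u + t • v) i
  have h2 : ‖u + t • v‖ ≤ ‖u‖ + |t| * ‖v‖ := by
    refine (norm_add_le _ _).trans ?_
    rw [norm_smul, Real.norm_eq_abs]
  have h3 : |c + c' * t - r (u + t • v) i| ≤ |c| + |c'| * |t| + |r (u + t • v) i| := by
    refine (abs_sub _ _).trans ?_
    have := abs_add_le c (c' * t)
    rw [abs_mul] at this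
    linarith
  have h4 : C₀ * ‖u + t • v‖ ≤ C₀ * (‖u‖ + |t| * ‖v‖) := by gcongr
  have h5 := abs_nonneg t
  have h6 : 0 ≤ |c| * |t| + |c'| + C₀ * (‖v‖ + ‖u‖ * |t|) := by positivity
  rw [hK]
  nlinarith

/-- The multiplicity of a zero of the restriction is at least the number of roots crossing there. -/
theorem IsRootFamily.card_le_rootMultiplicity (hr : IsRootFamily A q r) (u v : ℝ × ℝ)
    (c c' t₀ : ℝ) (hf : restrictLine q u v c c' ≠ 0) :
    (Finset.univ.filter fun i => c + c' * t₀ - r (u + t₀ • v) i = 0).card ≤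
      (restrictLine q u v c c').rootMultiplicity (t₀ : ℂ) := by
  classical
  have hc : Continuous fun t : ℝ => u + t • v := by fun_prop
  have hloc : ∀ i, ∃ K : ℝ, 0 < K ∧ ∀ᶠ t in 𝓝 t₀, |c + c' * t - r (u + t • v) i| ≤
      K * (if c + c' * t₀ - r (u + t₀ • v) i = 0 then |t - t₀| else 1) := by
    intro i
    by_cases hi : c + c' * t₀ - r (u + t₀ • v) i = 0
    · obtain ⟨C₀, hC₀, hev⟩ := hr.eventually_abs_sub_le (u + t₀ • v) i
      refine ⟨|c'| + C₀ * ‖v‖ + 1, by positivity, ?_⟩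
      filter_upwards [hc.continuousAt.eventually hev] with t ht
      rw [if_pos hi]
      have e1 : c + c' * t - r (u + t • v) i =
          c' * (t - t₀) - (r (u + t • v) i - r (u + t₀ • v) i) := by linarith
      have e2 : u + t • v - (u + t₀ • v) = (t - t₀) • v := by module
      rw [e2, norm_smul, Real.norm_eq_abs] at ht
      have h1 := abs_sub (c' * (t - t₀)) (r (u + t • v) i - r (u + t₀ • v) i)
      rw [abs_mul] at h1
      rw [e1]
      nlinarith [abs_nonneg (t - t₀)]
    · have hcont : Continuous fun t : ℝ => |c + c' * t - r (u + t • v) i| :=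
        ((by fun_prop : Continuous fun t : ℝ => c + c' * t).sub
          ((hr.continuous_apply i).comp hc)).abs
      refine ⟨|c + c' * t₀ - r (u + t₀ • v) i| + 1, by positivity, ?_⟩
      filter_upwards [hcont.continuousAt.eventually_lt continuousAt_const (lt_add_one _)] with t ht
      rw [if_neg hi, mul_one]
      exact ht.le
  choose K hK hKev using hloc
  refine le_rootMultiplicity_of_norm_eval_le hf (C := ∏ i, K i) ?_
  filter_upwards [eventually_all.mpr hKev] with t ht
  rw [hr.eval_restrictLine_eq, norm_prod]
  calc ∏ i, ‖((c + c' * t - r (u + t • v) i : ℝ) : ℂ)‖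
      ≤ ∏ i, (K i * (if c + c' * t₀ - r (u + t₀ • v) i = 0 then |t - t₀| else 1)) := by
        refine Finset.prod_le_prod (fun i _ => norm_nonneg _) fun i _ => ?_
        rw [Complex.norm_real, Real.norm_eq_abs]
        exact ht i
    _ = _ := by
        rw [Finset.prod_mul_distrib, Finset.prod_ite, Finset.prod_const, Finset.prod_const_one,
          mul_one]

/-- A count of zeros on the line `t ↦ (u + tv, c + c't)`. Each of the `d` factors changes sign on
the negative axis; if the bound failed, the top factor would vanish again in `(0, 1)`. That is `d +
1` zeros of a nonzero polynomial of degree at most `d`. -/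
theorem IsRootFamily.top_add_le_aux (hr : IsRootFamily A q r) (hd : 0 < d) (u v : ℝ × ℝ)
    {c c' : ℝ} (hc : r u ⟨0, hd⟩ < c) (hc' : r v ⟨0, hd⟩ < c') :
    r (u + v) ⟨0, hd⟩ ≤ c + c' := by
  classical
  by_contra hcon
  push Not at hcon
  set f := restrictLine q u v c c' with hf
  set g : Fin d → ℝ → ℝ := fun i t => c + c' * t - r (u + t • v) i with hg
  have hgc : ∀ i, Continuous (g i) := fun i =>
    (by fun_prop : Continuous fun t : ℝ => c + c' * t).sub
      ((hr.continuous_apply i).comp (by fun_prop))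
  have hg0 : ∀ i, 0 < g i 0 := fun i => by
    have : r u i ≤ r u ⟨0, hd⟩ := hr.antitone u (Fin.mk_le_of_le_val (Nat.zero_le _))
    simp only [hg, mul_zero, add_zero, zero_smul]
    linarith
  have hfne : f ≠ 0 := by
    intro h0
    have h1 := hr.eval_restrictLine_eq u v c c' 0
    rw [← hf, h0, eval_zero, eq_comm, Finset.prod_eq_zero_iff] at h1
    obtain ⟨i, -, hi⟩ := h1
    have hi' : g i 0 = 0 := Complex.ofReal_eq_zero.mp hi
    exact (hg0 i).ne' hi'
  obtain ⟨s, hs, hs0⟩ : ∃ s ∈ Set.Ioo (0 : ℝ) 1, g ⟨0, hd⟩ s = 0 := by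
    have h1 : g ⟨0, hd⟩ 1 < 0 := by
      simp only [hg, mul_one, one_smul]
      linarith
    exact intermediate_value_Ioo' zero_le_one (hgc _).continuousOn ⟨h1, hg0 _⟩
  -- With `T = 1/ε`, homogeneity turns behaviour at `-∞` into behaviour near `-v`, where the roots
  -- are the negated roots at `v` and so exceed `-c'`.
  obtain ⟨T, hT, hTneg⟩ : ∃ T : ℝ, 0 < T ∧ ∀ i, g i (-T) < 0 := by
    have hev : ∀ᶠ ε in 𝓝 (0 : ℝ), ∀ i, 0 < r (-v + ε • u) i - (-c' + ε * c) := by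
      rw [eventually_all]
      intro i
      have hcont : Continuous fun ε : ℝ => r (-v + ε • u) i - (-c' + ε * c) :=
        ((hr.continuous_apply i).comp (by fun_prop)).sub (by fun_prop)
      refine hcont.continuousAt.eventually (lt_mem_nhds ?_)
      simp only [zero_smul, add_zero, zero_mul]
      rw [hr.neg]
      have : r v i.rev ≤ r v ⟨0, hd⟩ := hr.antitone v (Fin.mk_le_of_le_val (Nat.zero_le _))
      linarith
    obtain ⟨ε, hε, hε0⟩ := ((hev.filter_mono nhdsWithin_le_nhds).and
      (self_mem_nhdsWithin : Set.Ioi (0 : ℝ) ∈ 𝓝[>] 0)).exists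
    have hε0' : 0 < ε := hε0
    refine ⟨ε⁻¹, inv_pos.mpr hε0', fun i => ?_⟩
    have e : u + (-ε⁻¹) • v = ε⁻¹ • (-v + ε • u) := by
      rw [smul_add, smul_smul, inv_mul_cancel₀ hε0'.ne']; module
    have h1 := mul_pos (inv_pos.mpr hε0') (hε i)
    simp only [hg]
    rw [e, hr.smul_of_pos _ (inv_pos.mpr hε0')]
    have h2 : ε⁻¹ * (ε * c) = c := by rw [← mul_assoc, inv_mul_cancel₀ hε0'.ne', one_mul]
    nlinarith
  have hz : ∀ i, ∃ z ∈ Set.Ioo (-T) 0, g i z = 0 := fun i =>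
    intermediate_value_Ioo (by linarith) (hgc i).continuousOn ⟨hTneg i, hg0 i⟩
  choose z hz hz0 using hz
  -- The `z i` may coincide, so zeros are counted with multiplicity.
  have hle : Multiset.map (fun x : ℝ => (x : ℂ)) (s ::ₘ Multiset.map z Finset.univ.val) ≤ f.roots := by
    rw [Multiset.le_iff_count]
    intro a
    rw [count_roots]
    by_cases ha : ∃ x : ℝ, (x : ℂ) = a
    · obtain ⟨x, rfl⟩ := ha
      rw [Multiset.count_map_eq_count' _ _ Complex.ofReal_injective]
      refine le_trans ?_ (hr.card_le_rootMultiplicity u v c c' x hfne)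
      by_cases hx : x = s
      · subst hx
        have h1 : Multiset.count x (Multiset.map z Finset.univ.val) = 0 := by
          rw [Multiset.count_eq_zero, Multiset.mem_map]
          rintro ⟨i, -, hi⟩
          have h2 := (hz i).2
          rw [hi] at h2
          exact absurd hs.1 (not_lt.mpr h2.le)
        rw [Multiset.count_cons_self, h1]
        exact Finset.card_pos.mpr ⟨⟨0, hd⟩, by simpa using hs0⟩
      · rw [Multiset.count_cons_of_ne hx, Multiset.count_map, ← Finset.filter_val, Finset.card_val]
        refine Finset.card_le_card fun i hi => ?_
        rw [Finset.mem_filter] at hi ⊢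
        refine ⟨hi.1, ?_⟩
        rw [hi.2]
        exact hz0 i
    · rw [Multiset.count_eq_zero.mpr]
      · exact Nat.zero_le _
      · rw [Multiset.mem_map]
        rintro ⟨x, -, hx⟩
        exact ha ⟨x, hx⟩
  have h1 := Multiset.card_le_card hle
  have h2 := f.card_roots'
  have h3 : f.natDegree ≤ d := hr.natDegree_restrictLine_le u v c c'
  simp only [Multiset.card_map, Multiset.card_cons, Finset.card_val, Finset.card_univ,
    Fintype.card_fin] at h1
  omega

/-- The largest root is subadditive. -/
theorem IsRootFamily.top_add_le (hr : IsRootFamily A q r) (hd : 0 < d) (u v : ℝ × ℝ) :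
    r (u + v) ⟨0, hd⟩ ≤ r u ⟨0, hd⟩ + r v ⟨0, hd⟩ := by
  refine le_of_forall_pos_le_add fun ε hε => ?_
  have := hr.top_add_le_aux hd u v (c := r u ⟨0, hd⟩ + ε / 2) (c' := r v ⟨0, hd⟩ + ε / 2)
    (by linarith) (by linarith)
  linarith

/-- The largest root has a supporting linear functional in each direction. -/
theorem IsRootFamily.exists_support (hr : IsRootFamily A q r) (hd : 0 < d) {u₀ : ℝ × ℝ}
    (hu₀ : u₀ ≠ 0) : ∃ w : ℂ, u₀.1 * w.re + u₀.2 * w.im = r u₀ ⟨0, hd⟩ ∧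
      ∀ u : ℝ × ℝ, u.1 * w.re + u.2 * w.im ≤ r u ⟨0, hd⟩ := by
  have hzero : r 0 ⟨0, hd⟩ = 0 := by
    obtain ⟨j, hj⟩ := hr.mem 0 ⟨0, hd⟩
    rw [hj, pencilEig_zero]
  have hneg : -r u₀ ⟨0, hd⟩ ≤ r (-u₀) ⟨0, hd⟩ := by
    have := hr.top_add_le hd u₀ (-u₀)
    rw [add_neg_cancel, hzero] at this
    linarith
  -- Hahn–Banach from the line `ℝ u₀`; `hneg` handles its negative half.
  obtain ⟨g, hg, hgle⟩ := exists_extension_of_le_sublinear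
    (LinearPMap.mkSpanSingleton (σ := RingHom.id ℝ) u₀ (r u₀ ⟨0, hd⟩) hu₀) (fun u => r u ⟨0, hd⟩)
    (fun c hc x => hr.smul_of_pos x hc _) (hr.top_add_le hd) (by
      rintro ⟨x, hx⟩
      obtain ⟨c, rfl⟩ := Submodule.mem_span_singleton.mp hx
      refine le_of_eq_of_le (LinearPMap.mkSpanSingleton'_apply u₀ _ _ c hx) ?_
      simp only [RingHom.id_apply, smul_eq_mul]
      rcases lt_trichotomy c 0 with hc | rfl | hc
      · have e : c • u₀ = (-c) • (-u₀) := by module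
        rw [e, hr.smul_of_pos _ (neg_pos.mpr hc)]
        nlinarith
      · rw [zero_smul, hzero, zero_mul]
      · rw [hr.smul_of_pos _ hc])
  have hlin : ∀ u : ℝ × ℝ, u.1 * g (1, 0) + u.2 * g (0, 1) = g u := by
    intro u
    have e : u = u.1 • ((1, 0) : ℝ × ℝ) + u.2 • ((0, 1) : ℝ × ℝ) := by ext <;> simp
    conv_rhs => rw [e, map_add, map_smul, map_smul]
    simp
  refine ⟨⟨g (1, 0), g (0, 1)⟩, ?_, fun u => ?_⟩
  · rw [hlin]
    exact (hg ⟨u₀, Submodule.mem_span_singleton_self u₀⟩).trans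
      (LinearPMap.mkSpanSingleton_apply ℝ ℝ hu₀ _)
  · rw [hlin]
    exact hgle u

end TopRoot

/-! ### Generic constancy of root multiplicities. -/

section GenericMultiplicity

open Polynomial

/-- If a monic prime `q` does not divide `c`, some nonzero constant lies in the ideal `(q, c)`. -/
theorem Polynomial.exists_C_mem_span_pair {R : Type*} [CommRing R] [IsDomain R] {q c : R[X]}
    (hq : q.Monic) (hp : Prime q) (hc : ¬ q ∣ c) :
    ∃ a : R, a ≠ 0 ∧ ∃ s t : R[X], C a = s * q + t * c := by
  have := AdjoinRoot.isDomain_of_prime hp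
  have := hq.finite_adjoinRoot
  have hne : AdjoinRoot.mk q c ≠ 0 := fun h => hc (AdjoinRoot.mk_eq_zero.mp h)
  -- `R[X]/(q)` is a domain integral over `R`, so the nonzero class of `c` divides a nonzero element
  -- of `R`.
  have halg : IsAlgebraic R (AdjoinRoot.mk q c) :=
    (Algebra.IsIntegral.isIntegral (R := R) (AdjoinRoot.mk q c)).isAlgebraic
  obtain ⟨a, ha, y, hy⟩ := halg.exists_nonzero_dvd (mem_nonZeroDivisors_of_ne_zero hne)
  obtain ⟨t, rfl⟩ := AdjoinRoot.mk_surjective y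
  rw [AdjoinRoot.algebraMap_eq, ← AdjoinRoot.mk_C, ← map_mul, AdjoinRoot.mk_eq_mk] at hy
  obtain ⟨s, hs⟩ := hy
  exact ⟨a, ha, s, t, by linear_combination hs⟩

/-- Generically, the roots of a monic prime `q` have a constant multiplicity as roots of `F`. -/
theorem exists_generic_rootMultiplicity {q F : (MvPolynomial (Fin 2) ℂ)[X]} (hq : q.Monic)
    (hp : Prime q) (hF : F.Monic) :
    ∃ (m : ℕ) (R₀ : MvPolynomial (Fin 2) ℂ), R₀ ≠ 0 ∧ ∀ u : ℝ × ℝ,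
      MvPolynomial.eval (planePoint u) R₀ ≠ 0 → ∀ x : ℂ, (specialize q u).IsRoot x →
        (specialize F u).rootMultiplicity x = m := by
  have hdeg : 0 < q.natDegree := by
    rcases Nat.eq_zero_or_pos q.natDegree with h | h
    · exact absurd (isUnit_one) (by rw [← hq.natDegree_eq_zero.mp h]; exact hp.not_isUnit)
    · exact h
  have hfin : FiniteMultiplicity q F := finiteMultiplicity_of_degree_pos_of_monic
    (natDegree_pos_iff_degree_pos.mp hdeg) hq hF.ne_zero
  obtain ⟨c, hFc, hc⟩ := hfin.exists_eq_pow_mul_and_not_dvd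
  have hder : ¬ q ∣ derivative q := by
    intro hdvd
    have h0 : derivative q ≠ 0 := fun h0 => hdeg.ne' (derivative_eq_zero.mp h0)
    exact absurd (natDegree_le_of_dvd hdvd h0) (not_le.mpr (natDegree_derivative_lt hdeg.ne'))
  -- These play the role of resultants: where `a b ≠ 0`, roots of `q` are simple and are not roots
  -- of the cofactor `c`, so their multiplicity in `F` is the exponent of `q`.
  obtain ⟨a, ha, s, t, hst⟩ := exists_C_mem_span_pair hq hp hc
  obtain ⟨b, hb, s', t', hst'⟩ := exists_C_mem_span_pair hq hp hder
  refine ⟨multiplicity q F, a * b, mul_ne_zero ha hb, fun u hu x hx => ?_⟩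
  rw [map_mul] at hu
  have hqne : specialize q u ≠ 0 := (hq.map _).ne_zero
  have hqx : (specialize q u).eval x = 0 := hx
  have hcx : (specialize c u).eval x ≠ 0 := by
    intro h0
    have h1 := congrArg (fun p => (specialize p u).eval x) hst
    simp only [specialize, Polynomial.map_add, Polynomial.map_mul, map_C, eval_add, eval_mul,
      eval_C] at h1 hqx h0
    rw [hqx, h0, mul_zero, mul_zero, add_zero] at h1
    exact left_ne_zero_of_mul hu h1
  have hdx : (derivative (specialize q u)).eval x ≠ 0 := by
    intro h0
    have h1 := congrArg (fun p => (specialize p u).eval x) hst'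
    rw [specialize, derivative_map] at h0
    simp only [specialize, Polynomial.map_add, Polynomial.map_mul, map_C, eval_add, eval_mul,
      eval_C] at h1 hqx h0
    rw [hqx, h0, mul_zero, mul_zero, add_zero] at h1
    exact right_ne_zero_of_mul hu h1
  have hone : (specialize q u).rootMultiplicity x = 1 := by
    have h1 := (rootMultiplicity_pos hqne).mpr hx
    have h2 := mt (one_lt_rootMultiplicity_iff_isRoot hqne (t := x)).mp
      (fun h => hdx h.2)
    omega
  have hFu : specialize F u = specialize q u ^ multiplicity q F * specialize c u := by
    conv_lhs => rw [hFc]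
    simp [specialize]
  have hcne : specialize c u ≠ 0 := by
    intro h0
    rw [h0, eval_zero] at hcx
    exact hcx rfl
  have hpow : ∀ m : ℕ, (specialize q u ^ m).rootMultiplicity x = m := by
    intro m
    rw [← count_roots, roots_pow, Multiset.count_nsmul, count_roots, hone, mul_one]
  rw [hFu, rootMultiplicity_mul (mul_ne_zero (pow_ne_zero _ hqne) hcne), hpow,
    rootMultiplicity_eq_zero hcx, add_zero]

/-- The nonvanishing locus of a nonzero polynomial is dense in the real plane. -/
theorem exists_mem_eval_ne_zero {R₀ : MvPolynomial (Fin 2) ℂ} (h : R₀ ≠ 0) {U : Set (ℝ × ℝ)}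
    (hU : IsOpen U) {u : ℝ × ℝ} (hu : u ∈ U) :
    ∃ v ∈ U, MvPolynomial.eval (planePoint v) R₀ ≠ 0 := by
  by_contra hcon
  push Not at hcon
  obtain ⟨V, W, hV, hW, huV, huW, hVW⟩ := isOpen_prod_iff.mp hU u.1 u.2 hu
  refine h (MvPolynomial.funext_set (![Complex.ofReal '' V, Complex.ofReal '' W]) ?_ ?_)
  · have inf : ∀ {S : Set ℝ} {x : ℝ}, IsOpen S → x ∈ S → (Complex.ofReal '' S).Infinite := by
      intro S x hS hx
      exact (infinite_of_mem_nhds x (hS.mem_nhds hx)).image Complex.ofReal_injective.injOn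
    intro i
    fin_cases i
    · exact inf hV huV
    · exact inf hW huW
  · intro x hx
    obtain ⟨a, ha, hxa⟩ := hx 0 (Set.mem_univ _)
    obtain ⟨b, hb, hxb⟩ := hx 1 (Set.mem_univ _)
    have e : x = planePoint (a, b) := by
      ext i
      fin_cases i
      · exact hxa.symm
      · exact hxb.symm
    rw [e, map_zero]
    exact hcon _ (hVW ⟨ha, hb⟩)

end GenericMultiplicity

/-! ### Comparison of the two pencils and the conclusion. -/

section Comparison

open Polynomial

variable {n : ℕ}

/-- Leading coefficients of factors of a monic polynomial are units, so irreducible factors can be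
rescaled to be monic. -/
theorem Polynomial.Monic.exists_monic_prime_factorization {R : Type*} [CommRing R] [IsDomain R]
    [UniqueFactorizationMonoid R] {F : R[X]} (hF : F.Monic) :
    ∃ s : Multiset R[X], (∀ q ∈ s, q.Monic ∧ Prime q) ∧ s.prod = F := by
  induction h : F.natDegree using Nat.strong_induction_on generalizing F with
  | _ k IH =>
    by_cases hu : IsUnit F
    · exact ⟨0, by simp, by rw [hF.eq_one_of_isUnit hu, Multiset.prod_zero]⟩
    obtain ⟨f, hf, g, rfl⟩ := WfDvdMonoid.exists_irreducible_factor hu hF.ne_zero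
    have hlc : f.leadingCoeff * g.leadingCoeff = 1 := by rw [← leadingCoeff_mul]; exact hF
    have hq : (C g.leadingCoeff * f).Monic := by
      rw [Monic, leadingCoeff_mul, leadingCoeff_C, mul_comm, hlc]
    have hg : (C f.leadingCoeff * g).Monic := by
      rw [Monic, leadingCoeff_mul, leadingCoeff_C, hlc]
    have hunit : IsUnit (C g.leadingCoeff) :=
      isUnit_C.mpr (IsUnit.of_mul_eq_one_right _ hlc)
    have hqp : Prime (C g.leadingCoeff * f) :=
      ((associated_unit_mul_left f _ hunit).symm.irreducible hf).prime
    have hprod : f * g = (C g.leadingCoeff * f) * (C f.leadingCoeff * g) := by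
      have : (C g.leadingCoeff * f) * (C f.leadingCoeff * g) =
          C (f.leadingCoeff * g.leadingCoeff) * (f * g) := by rw [C_mul]; ring
      rw [this, hlc, C_1, one_mul]
    have hdeg : 0 < (C g.leadingCoeff * f).natDegree := by
      rcases Nat.eq_zero_or_pos (C g.leadingCoeff * f).natDegree with h0 | h0
      · exact absurd isUnit_one (by rw [← hq.natDegree_eq_zero.mp h0]; exact hqp.not_isUnit)
      · exact h0
    have hlt : (C f.leadingCoeff * g).natDegree < k := by
      rw [← h, hprod, hq.natDegree_mul hg]
      omega
    obtain ⟨s, hs, hs'⟩ := IH _ hlt hg rfl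
    refine ⟨(C g.leadingCoeff * f) ::ₘ s, ?_, by rw [Multiset.prod_cons, hs', ← hprod]⟩
    intro q hq'
    rcases Multiset.mem_cons.mp hq' with rfl | hq'
    · exact ⟨hq, hqp⟩
    · exact hs q hq'

theorem rootMultiplicity_specialize_charpoly (A : Matrix (Fin n) (Fin n) ℂ) (u : ℝ × ℝ) (x : ℝ) :
    (specialize (genericPencil A).charpoly u).rootMultiplicity (x : ℂ) =
      (Finset.univ.filter fun j => pencilEig A u j = x).card := by
  classical
  rw [specialize_charpoly, ← count_roots,
    roots_prod _ _ (Finset.prod_ne_zero_iff.mpr fun i _ => X_sub_C_ne_zero _)]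
  simp only [roots_X_sub_C, Multiset.bind_singleton]
  rw [Multiset.count_map, ← Finset.filter_val, Finset.card_val]
  congr 1
  ext j
  simp [eq_comm]

theorem exists_generic_rootMultiplicities (A B : Matrix (Fin n) (Fin n) ℂ)
    (s : Multiset (MvPolynomial (Fin 2) ℂ)[X]) (hs : ∀ q ∈ s, q.Monic ∧ Prime q) :
    ∃ R₀ : MvPolynomial (Fin 2) ℂ, R₀ ≠ 0 ∧ ∀ q ∈ s, ∃ mA mB : ℕ, ∀ u : ℝ × ℝ,
      MvPolynomial.eval (planePoint u) R₀ ≠ 0 → ∀ x : ℝ, (specialize q u).IsRoot (x : ℂ) →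
        (Finset.univ.filter fun j => pencilEig A u j = x).card = mA ∧
        (Finset.univ.filter fun j => pencilEig B u j = x).card = mB := by
  induction s using Multiset.induction with
  | empty => exact ⟨1, one_ne_zero, by simp⟩
  | cons q s IH =>
    obtain ⟨R₀, hR₀, h⟩ := IH fun p hp => hs p (Multiset.mem_cons_of_mem hp)
    obtain ⟨hq, hqp⟩ := hs q (Multiset.mem_cons_self q s)
    obtain ⟨mA, RA, hRA, hA⟩ :=
      exists_generic_rootMultiplicity hq hqp (genericPencil A).charpoly_monic
    obtain ⟨mB, RB, hRB, hB⟩ :=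
      exists_generic_rootMultiplicity hq hqp (genericPencil B).charpoly_monic
    refine ⟨R₀ * (RA * RB), mul_ne_zero hR₀ (mul_ne_zero hRA hRB), fun p hp => ?_⟩
    rcases Multiset.mem_cons.mp hp with rfl | hp
    · refine ⟨mA, mB, fun u hu x hx => ?_⟩
      rw [map_mul, map_mul] at hu
      have hu' := right_ne_zero_of_mul hu
      rw [← rootMultiplicity_specialize_charpoly, ← rootMultiplicity_specialize_charpoly]
      exact ⟨hA u (left_ne_zero_of_mul hu') x hx, hB u (right_ne_zero_of_mul hu') x hx⟩
    · obtain ⟨m, m', hm⟩ := h p hp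
      refine ⟨m, m', fun u hu => hm u ?_⟩
      rw [map_mul] at hu
      exact left_ne_zero_of_mul hu

/-- The inductive step. The multiplicity comparison finds a convex minorant of the `i`-th eigenvalue
function of `A`, touching it at the point where the inequality is assumed to fail. -/
theorem pencilEig_le_of_rankNumericalRange_subset {A B : Matrix (Fin n) (Fin n) ℂ} {i : Fin n}
    (hΛ : rankNumericalRange (i + 1) A ⊆ rankNumericalRange (i + 1) B)
    (hlt : ∀ j < i, ∀ u, pencilEig A u j = pencilEig B u j) (u : ℝ × ℝ) :
    pencilEig A u i ≤ pencilEig B u i := by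
  by_contra hcon
  push Not at hcon
  obtain ⟨s, hs, hsF⟩ := (genericPencil A).charpoly_monic.exists_monic_prime_factorization
  obtain ⟨R₀, hR₀, hgen⟩ := exists_generic_rootMultiplicities A B s hs
  obtain ⟨u₀, hu₀, hu₀'⟩ := exists_mem_eval_ne_zero hR₀
    (isOpen_lt (continuous_pencilEig B i) (continuous_pencilEig A i)) hcon
  replace hu₀ : pencilEig B u₀ i < pencilEig A u₀ i := hu₀
  set x₀ := pencilEig A u₀ i with hx₀
  obtain ⟨q, hqs, hq₀⟩ : ∃ q ∈ s, (specialize q u₀).IsRoot (x₀ : ℂ) := by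
    have h1 : (specialize (genericPencil A).charpoly u₀).eval (x₀ : ℂ) = 0 := by
      rw [specialize_charpoly, eval_prod]
      exact Finset.prod_eq_zero (Finset.mem_univ i) (by simp [hx₀])
    have h2 : ∀ p, (specialize p u₀).eval (x₀ : ℂ) = ((evalRingHom (x₀ : ℂ)).comp
        (mapRingHom (MvPolynomial.eval (planePoint u₀)))) p := fun p => rfl
    rw [h2, ← hsF, map_multiset_prod, Multiset.prod_eq_zero_iff, Multiset.mem_map] at h1
    obtain ⟨q, hq, hq'⟩ := h1
    exact ⟨q, hq, by rw [IsRoot, h2]; exact hq'⟩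
  obtain ⟨mA, mB, hm⟩ := hgen q hqs
  obtain ⟨hqm, hqp⟩ := hs q hqs
  obtain ⟨r, hr⟩ := exists_isRootFamily A hqm (hsF ▸ Multiset.dvd_prod hqs)
  have hroot : ∀ v j, (specialize q v).IsRoot (r v j : ℂ) := fun v j => by
    rw [IsRoot, hr.eval_eq]
    exact Finset.prod_eq_zero (Finset.mem_univ j) (sub_self _)
  obtain ⟨j₀, hj₀⟩ : ∃ j, x₀ = r u₀ j := by
    rw [IsRoot, hr.eval_eq, Finset.prod_eq_zero_iff] at hq₀
    obtain ⟨j, -, hj⟩ := hq₀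
    exact ⟨j, by exact_mod_cast sub_eq_zero.mp hj⟩
  have hd : 0 < q.natDegree := j₀.pos
  -- At `u₀`, eigenvalues of `B` equal to `x₀` have index below `i`, so `A` shares them, and `A` has
  -- index `i` in addition.
  have hmBA : mB < mA := by
    rw [← (hm u₀ hu₀' x₀ hq₀).1, ← (hm u₀ hu₀' x₀ hq₀).2]
    refine Finset.card_lt_card ((Finset.ssubset_iff_of_subset ?_).mpr ⟨i, by simp [hx₀], ?_⟩)
    · intro j hj
      rw [Finset.mem_filter] at hj ⊢
      have hji : j < i := by
        by_contra hji
        have := pencilEig_antitone B u₀ (not_lt.mp hji)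
        rw [hj.2] at this
        linarith
      exact ⟨hj.1, by rw [hlt j hji, hj.2]⟩
    · simp [hu₀.ne]
  -- Otherwise, at a generic point, the top root occurs in `A` only at indices below `i`, where `A`
  -- and `B` agree; this gives `mA ≤ mB`.
  have htop : ∀ v, r v ⟨0, hd⟩ ≤ pencilEig A v i := by
    intro v
    by_contra hv
    push Not at hv
    obtain ⟨v', hv', hgv⟩ := exists_mem_eval_ne_zero hR₀
      (isOpen_lt (continuous_pencilEig A i) (hr.continuous_apply ⟨0, hd⟩)) hv
    replace hv' : pencilEig A v' i < r v' ⟨0, hd⟩ := hv'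
    obtain ⟨h1, h2⟩ := hm v' hgv _ (hroot v' ⟨0, hd⟩)
    refine absurd hmBA (not_lt.mpr ?_)
    rw [← h1, ← h2]
    refine Finset.card_le_card fun j hj => ?_
    rw [Finset.mem_filter] at hj ⊢
    have hji : j < i := by
      by_contra hji
      have := pencilEig_antitone A v' (not_lt.mp hji)
      rw [hj.2] at this
      linarith
    exact ⟨hj.1, by rw [← hlt j hji, hj.2]⟩
  have hx₀top : r u₀ ⟨0, hd⟩ = x₀ :=
    le_antisymm (htop u₀) (hj₀ ▸ hr.antitone u₀ (Fin.mk_le_of_le_val (Nat.zero_le _)))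
  have hu₀ne : u₀ ≠ 0 := by
    intro h0
    rw [hx₀, h0, pencilEig_zero, pencilEig_zero] at hu₀
    exact lt_irrefl _ hu₀
  obtain ⟨w, hw, hwle⟩ := hr.exists_support hd hu₀ne
  have hwA : w ∈ rankNumericalRange (i + 1) A :=
    (mem_rankNumericalRange_iff_le_pencilEig A i w).mpr fun v => (hwle v).trans (htop v)
  have := (mem_rankNumericalRange_iff_le_pencilEig B i w).mp (hΛ hwA) u₀
  linarith

theorem pencilEig_eq_of_rankNumericalRange_eq {A B : Matrix (Fin n) (Fin n) ℂ}
    (hAB : ∀ k : ℕ, 1 ≤ k → k ≤ n / 2 + 1 → rankNumericalRange k A = rankNumericalRange k B)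
    (u : ℝ × ℝ) (i : Fin n) : pencilEig A u i = pencilEig B u i := by
  have half : ∀ k : ℕ, ∀ i : Fin n, (i : ℕ) = k → k ≤ n / 2 →
      ∀ u, pencilEig A u i = pencilEig B u i := by
    intro k
    induction k using Nat.strong_induction_on with
    | _ k IH =>
      intro i hi hk u
      have hlt : ∀ j < i, ∀ u, pencilEig A u j = pencilEig B u j := fun j hj v =>
        IH j (by rw [← hi]; exact hj) j rfl (by have : (j : ℕ) < i := hj; omega) v
      have hΛ := hAB (i + 1) (by omega) (by omega)
      exact le_antisymm (pencilEig_le_of_rankNumericalRange_subset hΛ.subset hlt u)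
        (pencilEig_le_of_rankNumericalRange_subset hΛ.superset (fun j hj v => (hlt j hj v).symm) u)
  -- Indices start at `0`, so `i ≤ n / 2` corresponds to ranks up to `n / 2 + 1`; for larger `i` the
  -- reversed index lies in that range.
  by_cases hi : (i : ℕ) ≤ n / 2
  · exact half i i rfl hi u
  · have h1 := half i.rev i.rev rfl (by rw [Fin.val_rev]; omega) (-u)
    rw [pencilEig_neg, pencilEig_neg, Fin.rev_rev] at h1
    exact neg_injective h1

theorem eval_kippenhahnPoly (A : Matrix (Fin n) (Fin n) ℂ) (x y z : ℝ) :
    MvPolynomial.eval ![(x : ℂ), (y : ℂ), (z : ℂ)] (kippenhahnPoly A) =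
      (-1) ^ n * (hermPencil A (x, y)).charpoly.eval (-z : ℂ) := by
  have h : Matrix.scalar (Fin n) (-z : ℂ) - hermPencil A (x, y) =
      -(hermPencil A (x, y) + Matrix.scalar (Fin n) (z : ℂ)) := by
    rw [map_neg]; abel
  rw [Matrix.eval_charpoly, h, Matrix.det_neg, Fintype.card_fin, ← mul_assoc, ← mul_pow,
    neg_one_mul, neg_neg, one_pow, one_mul, kippenhahnPoly, RingHom.map_det]
  congr 1
  ext i j
  by_cases hij : i = j <;> simp [hermPencil, hij]

/-- The pencil eigenvalues fix the polynomial at all real points, and those suffice to determine it.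
-/
theorem kippenhahnPoly_eq_of_pencilEig_eq {A B : Matrix (Fin n) (Fin n) ℂ}
    (h : ∀ u i, pencilEig A u i = pencilEig B u i) : kippenhahnPoly A = kippenhahnPoly B := by
  refine MvPolynomial.funext_set (fun _ => Set.range Complex.ofReal)
    (fun _ => Set.infinite_range_of_injective Complex.ofReal_injective) fun p hp => ?_
  obtain ⟨x, hx⟩ := hp 0 (Set.mem_univ _)
  obtain ⟨y, hy⟩ := hp 1 (Set.mem_univ _)
  obtain ⟨z, hz⟩ := hp 2 (Set.mem_univ _)
  have e : p = ![(x : ℂ), (y : ℂ), (z : ℂ)] := by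
    ext i
    fin_cases i
    · exact hx.symm
    · exact hy.symm
    · exact hz.symm
  rw [e, eval_kippenhahnPoly, eval_kippenhahnPoly, charpoly_hermPencil, charpoly_hermPencil]
  simp only [h]

theorem eigenvalueRe_exp_smul (A : Matrix (Fin n) (Fin n) ℂ) (θ : ℝ) (ℓ : ℕ) (h₁ : 1 ≤ ℓ)
    (h₂ : ℓ ≤ n) :
    eigenvalueRe (Complex.exp (-(Complex.I * (θ : ℂ))) • A) ℓ h₁ h₂ =
      pencilEig A (Real.cos θ, Real.sin θ) ⟨ℓ - 1, by omega⟩ := by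
  have key : ∀ {M N : Matrix (Fin n) (Fin n) ℂ} (hM : M.IsHermitian) (hN : N.IsHermitian)
      (_ : M = N) (i : Fin (Fintype.card (Fin n))), hM.eigenvalues₀ i = hN.eigenvalues₀ i := by
    intro M N hM hN h i
    subst h
    rfl
  refine key _ _ ?_ _
  have hexp : Complex.exp (-(Complex.I * (θ : ℂ))) = Complex.cos θ - Complex.sin θ * Complex.I := by
    rw [mul_comm, ← neg_mul, Complex.exp_mul_I, Complex.cos_neg, Complex.sin_neg]
    ring
  have hconj : star (Complex.exp (-(Complex.I * (θ : ℂ)))) =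
      Complex.cos θ + Complex.sin θ * Complex.I := by
    rw [hexp, ← Complex.ofReal_cos, ← Complex.ofReal_sin]
    simp only [star_sub, star_mul', RCLike.star_def, Complex.conj_ofReal, Complex.conj_I, mul_neg,
      sub_neg_eq_add]
  rw [hermPencil_eq, realPart_apply_coe, Matrix.star_eq_conjTranspose, Matrix.conjTranspose_smul,
    hconj, hexp, Complex.ofReal_cos, Complex.ofReal_sin]
  ext i j
  simp [Complex.real_smul]
  ring

end Comparison

theorem lemma11 (n : ℕ) (A B : Matrix (Fin n) (Fin n) ℂ)
    (hAB : ∀ k : ℕ, 1 ≤ k → k ≤ n / 2 + 1 → rankNumericalRange k A = rankNumericalRange k B) :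
    ∀ (ℓ : ℕ) (h₁ : 1 ≤ ℓ) (h₂ : ℓ ≤ n / 2),
      linearFactorSet ℓ A = linearFactorSet ℓ B ∧
      ∀ θ : ℝ,
        eigenvalueRe (Complex.exp (-(Complex.I * (θ : ℂ))) • A) ℓ h₁
            (h₂.trans (Nat.div_le_self n 2)) =
          eigenvalueRe (Complex.exp (-(Complex.I * (θ : ℂ))) • B) ℓ h₁
            (h₂.trans (Nat.div_le_self n 2)) := by
  intro ℓ h₁ h₂
  have heig := pencilEig_eq_of_rankNumericalRange_eq hAB
  refine ⟨?_, fun θ => by rw [eigenvalueRe_exp_smul, eigenvalueRe_exp_smul, heig]⟩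
  ext w
  simp only [linearFactorSet, Set.mem_ofPred_eq, kippenhahnPoly_eq_of_pencilEig_eq heig]
  refine exists_congr fun m => and_congr_right fun hm => and_congr_right fun hm' => ?_
  -- The bound on `m` keeps both ranks between `1` and `n / 2 + 1`.
  rw [hAB (ℓ + m - 1) (by omega) (by omega), hAB (ℓ + m) (by omega) hm']
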